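/- **Setting.** Let $M\subset\mathbb R^2$ be a bounded domain with smooth boundary, $\mho=M\times(-1,0)$, $\Gamma_s=\partial M\times[-1,0]$, $\vec n$ the outward unit normal of $\partial M$, and $\kappa>0$. Let $V_1$ be the set of $v\in C^\infty(\overline{\mho};\mathbb R^2)$ with $\partial_z v=0$ at $z=0$ and $z=-1$, $v\cdot\vec n=0$ and $\partial_{\vec n}v\times\vec n=0$ on $\Gamma_s$, and $\int_{-1}^0\nabla\cdot v\,dz=0$, where $\nabla=(\partial_x,\partial_y)$. Let $V_2$ be the set of $\theta\in C^\infty(\overline{\mho})$ with $\partial_z\theta=0$ at $z=-1$, $\partial_z\theta+\kappa\theta=0$ at $z=0$, and $\partial_{\vec n}\theta=0$ on $\Gamma_s$. Let $\mathcal V_j$ be the closure of $V_j$ in $H^1$, let $H_1$ be the closure of $V_1$ in $L^2(\mho)^2$, and $H_2=L^2(\mho)$. Put $$\langle v,w\rangle_{\mathcal V_1}=\int_{\mho}(\nabla v\cdot\nabla w+\partial_zv\cdot\partial_zw),\qquad \langle \theta,\vartheta\rangle_{\mathcal V_2}=\int_{\mho}(\nabla \theta\cdot\nabla \vartheta+\partial_z\theta\,\partial_z\vartheta)+\kappa\int_{M}\theta\vartheta\big|_{z=0}.$$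 Let $A_j$ be the operator in $H_j$ with $v\in D(A_j)$, $A_jv=f$ if and only if $v\in\mathcal V_j$, $f\in H_j$ and $\langle v,w\rangle_{\mathcal V_j}=\langle f,w\rangle_{H_j}$ for all $w\in\mathcal V_j$; let $A_j^*$ be its adjoint in $H_j$, and $S_j(t)=e^{-tA_j}$. Let $H\in(0,1)$, $\alpha\in(1-H,\tfrac12)$, $T>0$, and let $(B_i)_{i\ge1}$ be independent real fractional Brownian motions with Hurst parameter $H$ on a probability space $(\Omega,\mathcal F,\mathbb P)$, that is, centered Gaussian processes on $[0,\infty)$ with covariance $\frac12(s^{2H}+t^{2H}-|s-t|^{2H})$ and a.s. continuous paths. For $j=1,2$ let $G_j$ be a positive self-adjoint trace-class operator on $H_j$, and let $(e_{i,j})_{i\ge1}$ be an orthonormal basis of $H_j$ of common eigenvectors of $G_j$ and $A_j$: $G_je_{i,j}=\lambda_{i,j}e_{i,j}$, $A_je_{i,j}=\gamma_{i,j}e_{i,j}$, $0<\gamma_{1,j}\le\gamma_{2,j}\le\cdots$. Put $W_j(t)=\sum_i\sqrt{\lambda_{i,j}}\,B_i(t)\,e_{i,j}$ (in $H_j$)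 and $$\int_0^tS_j(t-s)\,dW_j(s)=\sum_i\sqrt{\lambda_{i,j}}\int_0^tS_j(t-s)e_{i,j}\,dB_i(s)\quad\text{(convergence in }\mathcal V_j).$$ The integrals against $B_i$ are pathwise generalized Stieltjes integrals $$\int_0^tf\,dg=-\int_0^t D_{0+}^\alpha f(s)\,\widetilde D^{1-\alpha}_{t-}g_{t-}(s)\,ds,\qquad g_{t-}(s)=g(s)-g(t),$$ $$D^\alpha_{0+}f(s)=\tfrac1{\Gamma(1-\alpha)}\Big(\tfrac{f(s)}{s^\alpha}+\alpha\int_0^s\tfrac{f(s)-f(u)}{(s-u)^{\alpha+1}}du\Big),\qquad \widetilde D^{\beta}_{t-}g(s)=\tfrac1{\Gamma(1-\beta)}\Big(\tfrac{g(s)}{(t-s)^\beta}+\beta\int_s^t\tfrac{g(s)-g(u)}{(u-s)^{\beta+1}}du\Big).$$ Let $W^{\alpha,1}([0,T];\mathcal V_j)$ be the space of measurable $f:[0,T]\to\mathcal V_j$ with $\int_0^T\Big(\frac{\|f(s)\|}{s^\alpha}+\int_0^s\frac{\|f(s)-f(u)\|}{(s-u)^{\alpha+1}}du\Big)ds<\infty$,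 where $\|\cdot\|$ is the norm of $\mathcal V_j$. Consider the equation $dZ_j=-A_jZ_j\,dt+dW_j$, $Z_j(0)=0$, on $[0,T]$. * A *mild solution* is a $\mathcal V_j$-valued process $Z_j$ such that, with probability one, its path lies in $W^{\alpha,1}([0,T];\mathcal V_j)$ and, for all $t\in[0,T]$, the series above converges in $\mathcal V_j$ and $Z_j(t)=\int_0^tS_j(t-s)\,dW_j(s)$. * A *distributional (weak) solution* is an $H_j$-valued process $Z_j$ such that, with probability one, its path is Bochner integrable on $[0,T]$ and, for all $t\in[0,T]$ and all $\xi\in D(A_j^*)$, $$\langle Z_j(t),\xi\rangle=-\int_0^t\langle Z_j(s),A_j^*\xi\rangle\,ds+\langle W_j(t),\xi\rangle .$$ **Proposition 2.3.** Let $j\in\{1,2\}$ and let $Z_j$ be an $H_j$-valued process on $[0,T]$. 1. $Z_j$ is a mild solution if and only if it is a distributional solution whose paths lie, with probability one, in $W^{\alpha,1}([0,T];\mathcal V_j)$. 2. If $\sum_i\lambda_{i,j}^{1/2}\gamma_{i,j}^{5/2}<\infty$, then $Z_j$ is a mild solution if and only if it is a distributional solution. -/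

import Mathlib

open MeasureTheory ProbabilityTheory Set Filter Topology
open scoped NNReal ENNReal

noncomputable section

namespace FracPE

/-! ### The cylindrical domain -/

/-- The plane, containing the cross section `M`. -/
abbrev Plane : Type := EuclideanSpace ℝ (Fin 2)

/-- Physical space, containing the cylinder `M × (-1, 0)`. -/
abbrev Space : Type := EuclideanSpace ℝ (Fin 3)

/-- `ρ` is a smooth defining function of the planar set `M`: `M = {ρ < 0}`, and the gradient
of `ρ` does not vanish on `{ρ = 0}` (which is then the boundary of `M`). -/
def IsDefiningFunction (M : Set Plane) (ρ : Plane → ℝ) : Prop :=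
  ContDiff ℝ (⊤ : ℕ∞) ρ ∧ M = {x | ρ x < 0} ∧ ∀ x, ρ x = 0 → gradient ρ x ≠ 0

/-- `M` is a bounded domain of the plane with smooth boundary. -/
def IsSmoothBoundedDomain (M : Set Plane) : Prop :=
  IsOpen M ∧ IsConnected M ∧ Bornology.IsBounded M ∧ ∃ ρ, IsDefiningFunction M ρ

/-- `n` is the outward unit normal of `∂M` at the boundary point `x`. -/
def IsOutwardNormal (M : Set Plane) (x n : Plane) : Prop :=
  x ∈ frontier M ∧ ∃ ρ, IsDefiningFunction M ρ ∧ n = ‖gradient ρ x‖⁻¹ • gradient ρ x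

/-- The point `(x, z)` of space. -/
def point (x : Plane) (z : ℝ) : Space := !₂[x 0, x 1, z]

/-- The cylinder `M × (-1, 0)`. -/
def cylinder (M : Set Plane) : Set Space := {p | !₂[p 0, p 1] ∈ M ∧ p 2 ∈ Ioo (-1 : ℝ) 0}

/-- Lebesgue measure on the cylinder. -/
abbrev cylMeasure (M : Set Plane) : Measure Space := volume.restrict (cylinder M)

section Smooth

variable {F : Type} [NormedAddCommGroup F] [NormedSpace ℝ F]

/-- The partial derivative `∂ᵢ v` at `p`. -/
def partialD (i : Fin 3) (v : Space → F) (p : Space) : F :=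
  fderiv ℝ v p (EuclideanSpace.single i 1)

/-- The derivative of `v` at `p` in the horizontal direction `n`. -/
def horizD (n : Plane) (v : Space → F) (p : Space) : F :=
  n 0 • partialD 0 v p + n 1 • partialD 1 v p

/-- The full gradient `(∂₁ v, ∂₂ v, ∂₃ v)`; the inner product of two such triples is
`∇v · ∇w + ∂_z v · ∂_z w`. -/
def grad (v : Space → F) (p : Space) : PiLp 2 (fun _ : Fin 3 => F) :=
  WithLp.toLp 2 (fun i => partialD i v p)

end Smooth

/-- The smooth velocity fields on the closed cylinder (restrictions of smooth functions on the
whole space) with `∂_z v = 0` at top and bottom, `v · n = 0` and `∂_n v × n = 0` on the lateral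
boundary, and `∫_{-1}^0 ∇ · v dz = 0`. -/
def smoothVelocity (M : Set Plane) : Set (Space → Plane) :=
  {v | ContDiff ℝ (⊤ : ℕ∞) v ∧
    (∀ x ∈ M, partialD 2 v (point x 0) = 0 ∧ partialD 2 v (point x (-1)) = 0) ∧
    (∀ x n, IsOutwardNormal M x n → ∀ z ∈ Icc (-1 : ℝ) 0,
      v (point x z) 0 * n 0 + v (point x z) 1 * n 1 = 0 ∧
      horizD n v (point x z) 0 * n 1 - horizD n v (point x z) 1 * n 0 = 0) ∧
    (∀ x ∈ M, ∫ z in (-1 : ℝ)..0,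
      (partialD 0 v (point x z) 0 + partialD 1 v (point x z) 1) = 0)}

/-- The smooth temperatures on the closed cylinder with `∂_z θ = 0` at the bottom,
`∂_z θ + κ θ = 0` at the top and `∂_n θ = 0` on the lateral boundary. -/
def smoothTemperature (M : Set Plane) (κ : ℝ) : Set (Space → ℝ) :=
  {θ | ContDiff ℝ (⊤ : ℕ∞) θ ∧
    (∀ x ∈ M, partialD 2 θ (point x (-1)) = 0 ∧
      partialD 2 θ (point x 0) + κ * θ (point x 0) = 0) ∧
    (∀ x n, IsOutwardNormal M x n → ∀ z ∈ Icc (-1 : ℝ) 0, horizD n θ (point x z) = 0)}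

/-! ### The spaces `H₁`, `H₂`, `𝒱₁`, `𝒱₂` -/

/-- `H₁`: the closure in `L²` of the smooth velocity fields. -/
abbrev VelocityH (M : Set Plane) : Type :=
  ↥(Submodule.span ℝ {f : Lp Plane 2 (cylMeasure M) |
    ∃ v ∈ smoothVelocity M, f =ᵐ[cylMeasure M] v}).topologicalClosure

/-- `H₂ = L²` of the cylinder. -/
abbrev TemperatureH (M : Set Plane) : Type := Lp ℝ 2 (cylMeasure M)

/-- The `L²` space of gradients of velocity fields. -/
abbrev VelocityK (M : Set Plane) : Type :=
  Lp (PiLp 2 (fun _ : Fin 3 => Plane)) 2 (cylMeasure M)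

/-- The `L²` space of pairs (gradient of a temperature, trace on the top `z = 0`). -/
abbrev TemperatureK (M : Set Plane) : Type :=
  WithLp 2 (Lp (PiLp 2 (fun _ : Fin 3 => ℝ)) 2 (cylMeasure M) × Lp ℝ 2 (volume.restrict M))

/-- `𝒱₁`, the `H¹`-closure of the smooth velocity fields. An element `v` of `𝒱₁` is given
together with its gradient, as the pair `(v, ∇v)`, so that the closure in `H¹` is the closure in
`L² × L²`; the inner product of the second components is `⟨·,·⟩_{𝒱₁}`. -/
def velocityV (M : Set Plane) : Submodule ℝ (WithLp 2 (VelocityH M × VelocityK M)) :=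
  (Submodule.span ℝ {p | ∃ v ∈ smoothVelocity M,
    ((p.fst : Lp Plane 2 (cylMeasure M)) =ᵐ[cylMeasure M] v) ∧
    (p.snd =ᵐ[cylMeasure M] grad v)}).topologicalClosure

/-- `𝒱₂`, the `H¹`-closure of the smooth temperatures. An element `θ` of `𝒱₂` is given
together with its gradient and (`√κ` times) its trace on the top `z = 0`, which is continuous in
the `H¹`-norm; the inner product of the second components is
`⟨·,·⟩_{𝒱₂} = ∫ (∇θ · ∇θ' + ∂_z θ ∂_z θ') + κ ∫_{z = 0} θ θ'`. -/
def temperatureV (M : Set Plane) (κ : ℝ) :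
    Submodule ℝ (WithLp 2 (TemperatureH M × TemperatureK M)) :=
  (Submodule.span ℝ {p | ∃ θ ∈ smoothTemperature M κ,
    (p.fst =ᵐ[cylMeasure M] θ) ∧
    (p.snd.fst =ᵐ[cylMeasure M] grad θ) ∧
    (p.snd.snd =ᵐ[volume.restrict M] fun x => √κ * θ (point x 0))}).topologicalClosure

/-! ### The operators `A_j` and `A_j*`

Below `V` is a space of pairs `(v, Lv)` with `v ∈ H`, and the form is `⟨Lv, Lw⟩_K`; it will be
used for `velocityV` and `temperatureV`. -/

section Abstract

variable {H K : Type} [NormedAddCommGroup H] [InnerProductSpace ℝ H]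
  [NormedAddCommGroup K] [InnerProductSpace ℝ K]

/-- `v ∈ D(A)` and `A v = f ∈ H`: `⟨v, w⟩_𝒱 = ⟨f, w⟩_H` for all `w ∈ 𝒱`. -/
def OpA (V : Submodule ℝ (WithLp 2 (H × K))) (v : V) (f : H) : Prop :=
  ∀ w : V, inner ℝ v.1.snd w.1.snd = inner ℝ f w.1.fst

/-- `ξ ∈ D(A*)` and `A* ξ = η`, for the adjoint in `H` of the operator `A` with domain `D(A)`. -/
def OpAdj (V : Submodule ℝ (WithLp 2 (H × K))) (ξ η : H) : Prop :=
  ∀ (v : V) (f : H), OpA V v f → inner ℝ f ξ = inner ℝ v.1.fst η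

/-- A positive self-adjoint trace-class operator `G` on `H` and an orthonormal basis of `H` made of
common eigenvectors of `G` (eigenvalues `lam i`) and of `A` (eigenvalues `gam i`). -/
structure NoiseData (V : Submodule ℝ (WithLp 2 (H × K))) where
  /-- the covariance operator -/
  G : H →L[ℝ] H
  /-- the orthonormal basis -/
  e : HilbertBasis ℕ ℝ H
  /-- the basis vectors, as elements of `𝒱` -/
  f : ℕ → V
  /-- eigenvalues of the covariance operator -/
  lam : ℕ → ℝ
  /-- eigenvalues of `A` -/
  gam : ℕ → ℝ
  f_eq : ∀ i, (f i).1.fst = e i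
  G_pos : G.IsPositive
  G_eigen : ∀ i, G (e i) = lam i • e i
  G_trace : Summable fun i => inner ℝ (G (e i)) (e i)
  A_eigen : ∀ i, OpA V (f i) (gam i • e i)
  gam_pos : ∀ i, 0 < gam i
  gam_mono : Monotone gam

/-- The semigroup `S(τ) = e^{-Aτ}` on `𝒱`, `τ ≥ 0`, by the spectral decomposition of `A`. -/
def NoiseData.S {V : Submodule ℝ (WithLp 2 (H × K))} (N : NoiseData V) (τ : ℝ) (v : V) : V :=
  ∑' i, (Real.exp (-(N.gam i * τ)) * inner ℝ (N.e i) v.1.fst) • N.f i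

/-! ### Fractional calculus and the generalized Stieltjes integral -/

section Fractional

variable {E : Type} [NormedAddCommGroup E] [NormedSpace ℝ E]

/-- The Weyl derivative `D^α_{0+} f`. -/
def leftWeyl (α : ℝ) (f : ℝ → E) (t : ℝ) : E :=
  (Real.Gamma (1 - α))⁻¹ • ((t ^ α)⁻¹ • f t +
    α • ∫ u in (0 : ℝ)..t, ((t - u) ^ (α + 1))⁻¹ • (f t - f u))

/-- The Weyl derivative `D^β_{T-} g`, without its factor `(-1)^β`. -/
def rightWeyl (β T : ℝ) (g : ℝ → ℝ) (t : ℝ) : ℝ :=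
  (Real.Gamma (1 - β))⁻¹ * (g t / (T - t) ^ β +
    β * ∫ u in t..T, (g t - g u) / (u - t) ^ (β + 1))

/-- The generalized Stieltjes integral
`∫_0^T f dg = (-1)^α ∫_0^T D^α_{0+} f(s) D^{1-α}_{T-} g_{T-}(s) ds`, `g_{T-}(s) = g(s) - g(T)`.
The sign in front is `(-1)^α (-1)^{1-α} = -1`, as `rightWeyl` omits the factor `(-1)^{1-α}`. -/
def genStieltjes (α T : ℝ) (f : ℝ → E) (g : ℝ → ℝ) : E :=
  -∫ s in (0 : ℝ)..T, rightWeyl (1 - α) T (fun r => g r - g T) s • leftWeyl α f s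

/-- `f ∈ W^{α,1}([0,T]; E)`. -/
def MemW (α T : ℝ) (f : ℝ → E) : Prop :=
  AEStronglyMeasurable f (volume.restrict (Icc 0 T)) ∧
  ∫⁻ s in Ioo 0 T, (‖f s‖ₑ / ENNReal.ofReal (s ^ α) +
    ∫⁻ u in Ioo 0 s, ‖f s - f u‖ₑ / ENNReal.ofReal ((s - u) ^ (α + 1))) < ⊤

end Fractional

/-! ### Fractional Brownian motion and the two notions of solution -/

section Solutions

variable {Ω : Type*} [MeasurableSpace Ω]

/-- `B` is a one-dimensional fractional Brownian motion with Hurst parameter `h`: a centered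
Gaussian process with covariance `(s^{2h} + t^{2h} - |s - t|^{2h}) / 2` and a.s. continuous paths
(in particular `B 0 = 0` a.s.). -/
structure IsFBM (h : ℝ) (B : ℝ≥0 → Ω → ℝ) (P : Measure Ω) : Prop where
  gaussian : IsGaussianProcess B P
  centered : ∀ t, ∫ ω, B t ω ∂P = 0
  covariance : ∀ s t, ∫ ω, B s ω * B t ω ∂P =
    ((s : ℝ) ^ (2 * h) + (t : ℝ) ^ (2 * h) - |(s : ℝ) - t| ^ (2 * h)) / 2
  continuous_paths : ∀ᵐ ω ∂P, Continuous fun t => B t ω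

variable {V : Submodule ℝ (WithLp 2 (H × K))}

/-- The fractional Wiener process `W(t) = ∑ᵢ √λᵢ Bᵢ(t) eᵢ`, a series in `H`. -/
def NoiseData.W (N : NoiseData V) (B : ℕ → ℝ≥0 → Ω → ℝ) (t : ℝ) (ω : Ω) : H :=
  ∑' i, (√(N.lam i) * B i t.toNNReal ω) • N.e i

/-- The `i`-th term `√λᵢ ∫_0^t S(t-s) eᵢ dBᵢ(s) ∈ 𝒱` of `∫_0^t S(t-s) dW(s)`. -/
def NoiseData.convTerm (N : NoiseData V) (α : ℝ) (B : ℕ → ℝ≥0 → Ω → ℝ) (t : ℝ) (ω : Ω)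
    (i : ℕ) : V :=
  √(N.lam i) • genStieltjes α t (fun s => N.S (t - s) (N.f i)) (fun s => B i s.toNNReal ω)

/-- The function `z : [0,T] → H` has values in `𝒱`, where it is the function `ζ`, and `ζ` belongs
to `W^{α,1}([0,T]; 𝒱)`. -/
def IsRegularLift (V : Submodule ℝ (WithLp 2 (H × K))) (α T : ℝ) (z : ℝ → H) (ζ : ℝ → V) : Prop :=
  (∀ t ∈ Icc 0 T, (ζ t).1.fst = z t) ∧ MemW α T ζ

/-- With probability one the path of `Z` belongs to `W^{α,1}([0,T]; 𝒱)`. -/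
def HasRegularPaths (V : Submodule ℝ (WithLp 2 (H × K))) (P : Measure Ω) (α T : ℝ)
    (Z : ℝ → Ω → H) : Prop :=
  ∀ᵐ ω ∂P, ∃ ζ : ℝ → V, IsRegularLift V α T (fun t => Z t ω) ζ

/-- `Z` is a mild solution of `dZ = -A Z dt + dW`, `Z(0) = 0`, on `[0,T]`: a `𝒱`-valued process
with paths in `W^{α,1}([0,T]; 𝒱)` and `Z(t) = ∫_0^t S(t-s) dW(s)` for all `t ∈ [0,T]`, the series
defining the integral being convergent in `𝒱`. -/
def IsMildSolution (N : NoiseData V) (P : Measure Ω) (B : ℕ → ℝ≥0 → Ω → ℝ) (α T : ℝ)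
    (Z : ℝ → Ω → H) : Prop :=
  (∀ t ∈ Icc 0 T, AEStronglyMeasurable (Z t) P) ∧
  ∀ᵐ ω ∂P, ∃ ζ : ℝ → V, IsRegularLift V α T (fun t => Z t ω) ζ ∧
    ∀ t ∈ Icc 0 T, HasSum (fun i => N.convTerm α B t ω i) (ζ t)

/-- `Z` is a distributional (weak) solution of `dZ = -A Z dt + dW`, `Z(0) = 0`, on `[0,T]`: an
`H`-valued process with integrable paths such that, with probability one, for all `t ∈ [0,T]` and
`ξ ∈ D(A*)`, `⟨Z(t), ξ⟩ = -∫_0^t ⟨Z(s), A* ξ⟩ ds + ⟨W(t), ξ⟩`. -/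
def IsDistributionalSolution (N : NoiseData V) (P : Measure Ω) (B : ℕ → ℝ≥0 → Ω → ℝ) (T : ℝ)
    (Z : ℝ → Ω → H) : Prop :=
  (∀ t ∈ Icc 0 T, AEStronglyMeasurable (Z t) P) ∧
  ∀ᵐ ω ∂P, IntegrableOn (fun s => Z s ω) (Icc 0 T) ∧
    ∀ t ∈ Icc 0 T, ∀ ξ η : H, OpAdj V ξ η →
      inner ℝ (Z t ω) ξ = -(∫ s in (0 : ℝ)..t, inner ℝ (Z s ω) η) + inner ℝ (N.W B t ω) ξ

end Solutions

end Abstract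

end FracPE

end

/-!
Both equivalences are proved path by path, on an event of probability one. Expanding in the
eigenvectors `eᵢ` of `A`, both notions of solution say that the `i`-th coefficient of `Z` is
`√λᵢ xᵢ`, where `xᵢ` solves the scalar equation `dxᵢ = -γᵢ xᵢ dt + dBᵢ`, `xᵢ(0) = 0`.

* In the mild formulation `xᵢ(t)` is the generalized Stieltjes integral of `s ↦ e^{-γᵢ(t-s)}`
  against `Bᵢ`. Integration by parts (`genStieltjes_eq_of_hasDerivAt`) turns it into
  `Bᵢ(t) - γᵢ ∫_0^t e^{-γᵢ(t-s)} Bᵢ(s) ds`, called `ouPath`. The formula rests on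
  `integral_rpow_mul_rightWeyl`: the fractional integral of order `β = 1 - α` inverts the right Weyl
  derivative of order `β`. This is shown by cutting the derivative off near the diagonal, which
  after Fubini's theorem leaves the integral of the path against an explicit approximate identity.
* In the weak formulation, testing with `eᵢ` gives the integrated scalar equation, whose only
  integrable solution is `ouPath` (`eq_ouPath`); conversely the weak equation is recovered from the
  coefficients by Parseval's identity, since `⟨eᵢ, A* ξ⟩ = γᵢ ⟨eᵢ, ξ⟩`.

If in addition the path of `Z` has a lift to `𝒱` in `W^{α,1}`, then the series of the mild
formulation is the expansion of the lift in the eigenvectors, which are orthogonal in `𝒱`. It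
converges to the orthogonal projection of the lift to their closed span
(`NoiseData.hasSum_starProjection`). The projection does not change the element of `H`, and it is
again in `W^{α,1}`, so it can serve as the lift, without any appeal to the injectivity of
`𝒱 → H`.

The almost sure properties of the noise come from a single random variable per path, `pathEnergy`:
a fractional Sobolev seminorm together with a weighted `L²`-norm. As `h > 1 - α > 1/2`, its
expectation is finite and bounded uniformly in `i`, by the second moments of the increments alone
(`IsFBM.lintegral_pathEnergy_le`), and it bounds the supremum of the path
(`sq_le_pathEnergy`, again by the inversion formula). Hence `∑ λᵢ sup Bᵢ² < ∞` almost surely, so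
that `W(t)` converges in `H` for all `t` at once. The energy also bounds the norm of `xᵢ` in
`W^{α,1}`, up to a factor `1 + γᵢ` (`lintegral_ouPath_le`). As `fᵢ`, which is `eᵢ` seen in `𝒱`, has
norm `(1 + γᵢ)^{1/2}`, the summability assumption of the second half makes the series of the
`√λᵢ xᵢ fᵢ` converge in `W^{α,1}`, and every distributional solution is regular.
-/

namespace FracPE

/-! ### Power kernels on an interval -/

lemma integral_Ioo_rpow_mul_sub_rpow {β τ : ℝ} (hβ : β ∈ Ioo (0 : ℝ) 1) (hτ : 0 < τ) :
    ∫ s in Ioo 0 τ, s ^ (β - 1) * (τ - s) ^ (-β) = Real.Gamma β * Real.Gamma (1 - β) := by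
  have h := Complex.betaIntegral_scaled (β : ℂ) ((1 - β : ℝ) : ℂ) hτ
  rw [← integral_Ioc_eq_integral_Ioo, ← intervalIntegral.integral_of_le hτ.le]
  have h2 : ∫ x in (0 : ℝ)..τ, (x : ℂ) ^ ((β : ℂ) - 1) * ((τ : ℂ) - x) ^ (((1 - β : ℝ) : ℂ) - 1)
      = ((∫ s in (0 : ℝ)..τ, s ^ (β - 1) * (τ - s) ^ (-β) : ℝ) : ℂ) := by
    rw [← intervalIntegral.integral_ofReal]
    refine intervalIntegral.integral_congr fun s hs => ?_
    rw [uIcc_of_le hτ.le] at hs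
    simp only [Complex.ofReal_mul]
    rw [Complex.ofReal_cpow hs.1, Complex.ofReal_cpow (sub_nonneg.2 hs.2)]
    push_cast
    ring_nf
  rw [h2] at h
  have h3 : (β : ℂ) + ((1 - β : ℝ) : ℂ) - 1 = 0 := by push_cast; ring
  rw [h3, Complex.cpow_zero, one_mul] at h
  have h4 := ProbabilityTheory.beta_eq_betaIntegralReal β (1 - β) hβ.1 (sub_pos.2 hβ.2)
  rw [← h, Complex.ofReal_re, ProbabilityTheory.beta] at h4
  rw [← h4]
  simp

lemma integrableOn_rpow_mul_sub_rpow {β τ : ℝ} (hβ : β ∈ Ioo (0 : ℝ) 1) (hτ : 0 < τ) :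
    IntegrableOn (fun s => s ^ (β - 1) * (τ - s) ^ (-β)) (Ioo 0 τ) := by
  refine Integrable.of_integral_ne_zero ?_
  rw [integral_Ioo_rpow_mul_sub_rpow hβ hτ]
  exact (mul_pos (Real.Gamma_pos_of_pos hβ.1)
    (Real.Gamma_pos_of_pos (sub_pos.2 hβ.2))).ne'

lemma integrableOn_Ioo_rpow {p τ : ℝ} (hp : -1 < p) :
    IntegrableOn (fun s : ℝ => s ^ p) (Ioo 0 τ) := by
  rcases le_or_gt τ 0 with h | h
  · simp [Ioo_eq_empty_of_le h]
  · have := intervalIntegral.intervalIntegrable_rpow' (a := 0) (b := τ) hp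
    rw [intervalIntegrable_iff_integrableOn_Ioo_of_le h.le] at this
    exact this

lemma integral_indicator_Ioi_sub_rpow {β τ ε s : ℝ} (hβ : 0 < β) (hε : 0 < ε)
    (hs : s ∈ Ioo 0 τ) :
    ∫ r in Ioo 0 τ, (Ioi (s + ε)).indicator (fun r => (r - s) ^ (-β - 1)) r =
      β⁻¹ * (ε ^ (-β) - max ε (τ - s) ^ (-β)) := by
  have hset : Ioo 0 τ ∩ Ioi (s + ε) = Ioo (s + ε) τ := by
    ext r
    simp only [mem_inter_iff, mem_Ioo, mem_Ioi]
    constructor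
    · rintro ⟨⟨-, h⟩, h'⟩; exact ⟨h', h⟩
    · rintro ⟨h', h⟩; exact ⟨⟨by linarith [hs.1], h⟩, h'⟩
  rw [setIntegral_indicator measurableSet_Ioi, hset]
  rcases le_or_gt τ (s + ε) with h | h
  · rw [Ioo_eq_empty_of_le h, max_eq_left (by linarith)]
    simp
  · rw [← integral_Ioc_eq_integral_Ioo, ← intervalIntegral.integral_of_le h.le,
      intervalIntegral.integral_comp_sub_right (fun r => r ^ (-β - 1)), max_eq_right (by linarith),
      integral_rpow]
    · have : β ≠ 0 := hβ.ne'
      rw [show s + ε - s = ε by ring, show -β - 1 + 1 = -β by ring]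
      field_simp
      ring
    · right
      refine ⟨by linarith, ?_⟩
      rw [show s + ε - s = ε by ring, uIcc_of_le (by linarith)]
      intro h0
      linarith [h0.1]

lemma integral_Ioo_rpow_mul_rpow {β r a : ℝ} (hβ : β ∈ Ioo (0 : ℝ) 1) (ha : 0 ≤ a) (har : a < r) :
    ∫ s in Ioo 0 a, s ^ (β - 1) * (r - s) ^ (-β - 1) = β⁻¹ * (r⁻¹ * (a / (r - a)) ^ β) := by
  have hr : 0 < r := ha.trans_lt har
  rw [← integral_Ioc_eq_integral_Ioo, ← intervalIntegral.integral_of_le ha]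
  have hβ0 : β ≠ 0 := hβ.1.ne'
  have key := intervalIntegral.integral_eq_sub_of_hasDerivAt_of_le
    (f := fun s => β⁻¹ * (r⁻¹ * (s / (r - s)) ^ β))
    (f' := fun s => s ^ (β - 1) * (r - s) ^ (-β - 1)) ha ?_ ?_ ?_
  · rw [key]
    simp [Real.zero_rpow hβ0]
  · refine continuousOn_const.mul (continuousOn_const.mul (ContinuousOn.rpow_const ?_ ?_))
    · refine continuousOn_id.div (continuousOn_const.sub continuousOn_id) fun x hx => ?_
      have := hx.2
      exact (sub_pos.2 (this.trans_lt har)).ne'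
    · intro x hx
      exact Or.inr hβ.1.le
  · intro s hs
    have hrs : 0 < r - s := by linarith [hs.2]
    have h1 : HasDerivAt (fun s : ℝ => s / (r - s)) (r / (r - s) ^ 2) s := by
      have := (hasDerivAt_id s).div ((hasDerivAt_const s r).sub (hasDerivAt_id s)) hrs.ne'
      refine this.congr_deriv ?_
      simp
    have h2 := ((h1.rpow_const (p := β) (Or.inl (div_pos hs.1 hrs).ne')).const_mul r⁻¹).const_mul β⁻¹
    refine h2.congr_deriv ?_
    have e : (r - s) ^ (-β - 1) = ((r - s) ^ (β - 1))⁻¹ / (r - s) ^ 2 := by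
      rw [show -β - 1 = -(β - 1) - (2 : ℕ) by push_cast; ring, Real.rpow_sub_natCast hrs.ne',
        Real.rpow_neg hrs.le]
    rw [e, Real.div_rpow hs.1.le hrs.le]
    have : (r - s) ^ (β - 1) ≠ 0 := (Real.rpow_pos_of_pos hrs _).ne'
    field_simp
  · rw [intervalIntegrable_iff_integrableOn_Ioo_of_le ha]
    refine (integrableOn_Ioo_rpow (by linarith [hβ.1])).mul_continuousOn_of_subset
      (K := Icc 0 a) ?_ measurableSet_Ioo isCompact_Icc Ioo_subset_Icc_self
    refine (continuousOn_const.sub continuousOn_id).rpow_const fun x hx => Or.inl ?_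
    have := hx.2
    exact (sub_pos.2 (this.trans_lt har)).ne'

/-- The approximate identity on `(0, ∞)` that arises when the right Weyl derivative of order `β`
is truncated at distance `ε` from the diagonal and then integrated against `s ^ (β - 1)`. -/
noncomputable def weylKernel (β ε s : ℝ) : ℝ :=
  ε ^ (-β) * (s ^ (β - 1) - s⁻¹ * max (s - ε) 0 ^ β)

lemma weylKernel_nonneg {β ε s : ℝ} (hβ : 0 < β) (hε : 0 < ε) (hs : 0 < s) :
    0 ≤ weylKernel β ε s := by
  refine mul_nonneg (Real.rpow_nonneg hε.le _) (sub_nonneg.2 ?_)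
  rw [Real.rpow_sub_one hs.ne', div_eq_inv_mul]
  gcongr
  exact max_le (by linarith) hs.le

lemma weylKernel_le {β ε s : ℝ} (hβ : β ∈ Ioo (0 : ℝ) 1) (hε : 0 < ε) (hs : ε ≤ s) :
    weylKernel β ε s ≤ ε ^ (1 - β) * s ^ (β - 2) := by
  have hs0 : 0 < s := hε.trans_le hs
  rw [weylKernel, max_eq_left (by linarith)]
  have h1 : s ^ β - s ^ (β - 1) * ε ≤ (s - ε) ^ β := by
    have h2 : (s - ε) / s ≤ ((s - ε) / s) ^ β :=
      Real.self_le_rpow_of_le_one (div_nonneg (by linarith) hs0.le)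
        ((div_le_one hs0).2 (by linarith)) hβ.2.le
    rw [Real.div_rpow (by linarith) hs0.le, div_le_div_iff₀ hs0 (Real.rpow_pos_of_pos hs0 _)] at h2
    rw [Real.rpow_sub_one hs0.ne']
    field_simp
    linarith
  rw [show 1 - β = -β + 1 by ring, Real.rpow_add_one hε.ne', mul_assoc]
  gcongr
  rw [show β - 2 = β - 1 - 1 by ring, Real.rpow_sub_one hs0.ne' (β - 1)]
  have h3 : s ^ (β - 1) = s⁻¹ * s ^ β := by rw [Real.rpow_sub_one hs0.ne', div_eq_inv_mul]
  have h4 : s⁻¹ * (s ^ β - s ^ (β - 1) * ε) ≤ s⁻¹ * (s - ε) ^ β := by gcongr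
  have h5 : ε * (s ^ (β - 1) / s) = s⁻¹ * (s ^ (β - 1) * ε) := by field_simp
  rw [h5]
  nth_rewrite 1 [h3]
  linarith

/-! ### Fractional integration inverts the right Weyl derivative -/

lemma ae_mem_prod_restrict_Ioo (τ : ℝ) :
    ∀ᵐ p : ℝ × ℝ ∂(volume.restrict (Ioo 0 τ)).prod (volume.restrict (Ioo 0 τ)),
      p.1 ∈ Ioo 0 τ ∧ p.2 ∈ Ioo 0 τ := by
  rw [Measure.prod_restrict]
  filter_upwards [ae_restrict_mem (measurableSet_Ioo.prod measurableSet_Ioo)] with p hp using hp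

/-- The kernel of the right Weyl derivative of order `β`, weighted by `s ^ (β - 1)` and truncated
at distance `ε` from the diagonal. -/
noncomputable def truncKernel (β ε : ℝ) : ℝ × ℝ → ℝ :=
  {p | p.1 + ε < p.2}.indicator fun p => p.1 ^ (β - 1) * (p.2 - p.1) ^ (-β - 1)

lemma measurable_truncKernel (β ε : ℝ) : Measurable (truncKernel β ε) :=
  Measurable.indicator (by fun_prop) (measurableSet_lt (by fun_prop) (by fun_prop))

lemma integrable_truncKernel {β ε τ : ℝ} (hβ : β ∈ Ioo (0 : ℝ) 1) (hε : 0 < ε) :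
    Integrable (truncKernel β ε)
      ((volume.restrict (Ioo 0 τ)).prod (volume.restrict (Ioo 0 τ))) := by
  have h := Integrable.mul_prod (integrableOn_Ioo_rpow (p := β - 1) (τ := τ) (by linarith [hβ.1]))
    (integrable_const (ε ^ (-β - 1)) : Integrable _ (volume.restrict (Ioo (0 : ℝ) τ)))
  refine h.mono' (measurable_truncKernel β ε).aestronglyMeasurable ?_
  filter_upwards [ae_mem_prod_restrict_Ioo τ] with p hp
  have h1 : 0 ≤ p.1 ^ (β - 1) := Real.rpow_nonneg hp.1.1.le _
  rw [truncKernel, indicator_apply]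
  split_ifs with hlt
  · have hlt' : ε < p.2 - p.1 := by have : p.1 + ε < p.2 := hlt; linarith
    rw [Real.norm_of_nonneg (mul_nonneg h1 (Real.rpow_nonneg (hε.trans hlt').le _))]
    exact mul_le_mul_of_nonneg_left
      (Real.rpow_le_rpow_of_nonpos hε hlt'.le (by linarith [hβ.1])) h1
  · rw [norm_zero]
    exact mul_nonneg h1 (Real.rpow_nonneg hε.le _)

lemma exists_bound_Ioo {G : ℝ → ℝ} (hG : Continuous G) (τ : ℝ) :
    ∃ C, 0 ≤ C ∧ ∀ s ∈ Ioo 0 τ, ‖G s‖ ≤ C := by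
  obtain ⟨C, hC⟩ := (isCompact_Icc (a := (0 : ℝ)) (b := τ)).exists_bound_of_continuousOn
    hG.continuousOn
  exact ⟨max C 0, le_max_right _ _, fun s hs => (hC s (Ioo_subset_Icc_self hs)).trans
    (le_max_left _ _)⟩

lemma integrable_truncKernel_mul {β ε τ : ℝ} (hβ : β ∈ Ioo (0 : ℝ) 1) (hε : 0 < ε)
    {f : ℝ × ℝ → ℝ} (hf : Continuous f) :
    Integrable (fun p => truncKernel β ε p * f p)
      ((volume.restrict (Ioo 0 τ)).prod (volume.restrict (Ioo 0 τ))) := by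
  obtain ⟨C, hC⟩ := ((isCompact_Icc (a := (0 : ℝ)) (b := τ)).prod
    (isCompact_Icc (a := (0 : ℝ)) (b := τ))).exists_bound_of_continuousOn hf.continuousOn
  refine (integrable_truncKernel hβ hε).mul_bdd (c := C) hf.aestronglyMeasurable ?_
  filter_upwards [ae_mem_prod_restrict_Ioo τ] with p hp
  exact hC p ⟨Ioo_subset_Icc_self hp.1, Ioo_subset_Icc_self hp.2⟩

lemma norm_rpow_mul_max_rpow_le {β ε τ s C x : ℝ} (hβ : 0 < β) (hs : s ∈ Ioo 0 τ)
    (hx : ‖x‖ ≤ C) :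
    ‖s ^ (β - 1) * max ε (τ - s) ^ (-β) * x‖ ≤ s ^ (β - 1) * (τ - s) ^ (-β) * C := by
  have h1 : 0 ≤ s ^ (β - 1) := Real.rpow_nonneg hs.1.le _
  have h0 : 0 < τ - s := sub_pos.2 hs.2
  have h2 : 0 ≤ max ε (τ - s) ^ (-β) := Real.rpow_nonneg (le_max_of_le_right h0.le) _
  have h3 : max ε (τ - s) ^ (-β) ≤ (τ - s) ^ (-β) :=
    Real.rpow_le_rpow_of_nonpos h0 (le_max_right _ _) (by linarith)
  rw [norm_mul, norm_mul, Real.norm_of_nonneg h1, Real.norm_of_nonneg h2]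
  gcongr

/-- Fubini's theorem for the truncated right Weyl derivative. The boundary term is written with
`max ε (τ - s)`, so that it absorbs what the truncation removes near the right end point. -/
lemma integral_truncated {β ε τ : ℝ} (hβ : β ∈ Ioo (0 : ℝ) 1) (hε : 0 < ε) (hτ : 0 < τ)
    {G : ℝ → ℝ} (hG : Continuous G) :
    (∫ s in Ioo 0 τ, s ^ (β - 1) * max ε (τ - s) ^ (-β) * G s) +
      β * ∫ p, truncKernel β ε p * (G p.1 - G p.2)
        ∂(volume.restrict (Ioo 0 τ)).prod (volume.restrict (Ioo 0 τ)) =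
    ∫ s in Ioo 0 τ, weylKernel β ε s * G s := by
  have hβ0 : β ≠ 0 := hβ.1.ne'
  obtain ⟨C, -, hC⟩ := exists_bound_Ioo hG τ
  have i1 := integrable_truncKernel_mul (τ := τ) hβ hε (f := fun p => G p.1) (by fun_prop)
  have i2 := integrable_truncKernel_mul (τ := τ) hβ hε (f := fun p => G p.2) (by fun_prop)
  have i0 : IntegrableOn (fun s => s ^ (β - 1) * max ε (τ - s) ^ (-β) * G s) (Ioo 0 τ) := by
    refine ((integrableOn_rpow_mul_sub_rpow hβ hτ).mul_const C).mono'
      (by fun_prop) ?_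
    filter_upwards [ae_restrict_mem measurableSet_Ioo] with s hs
    exact norm_rpow_mul_max_rpow_le hβ.1 hs (hC s hs)
  simp_rw [mul_sub]
  rw [integral_sub i1 i2, integral_prod _ i1, integral_prod_symm _ i2,
    ← integral_sub i1.integral_prod_left i2.integral_prod_right, ← integral_const_mul]
  refine (integral_add i0
    ((i1.integral_prod_left.sub i2.integral_prod_right).const_mul β)).symm.trans ?_
  refine setIntegral_congr_fun measurableSet_Ioo fun s hs => ?_
  have e1 : ∫ r in Ioo 0 τ, truncKernel β ε (s, r) * G s =
      s ^ (β - 1) * (β⁻¹ * (ε ^ (-β) - max ε (τ - s) ^ (-β))) * G s := by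
    rw [integral_mul_const, ← integral_indicator_Ioi_sub_rpow hβ.1 hε hs, ← integral_const_mul]
    congr 2
    ext r
    simp only [truncKernel, indicator_apply, mem_ofPred_eq, mem_Ioi, mul_ite, mul_zero]
  have e2 : ∫ r in Ioo 0 τ, truncKernel β ε (r, s) * G s =
      β⁻¹ * (s⁻¹ * ε ^ (-β) * max (s - ε) 0 ^ β) * G s := by
    rw [integral_mul_const]
    congr 1
    have : (fun r => truncKernel β ε (r, s)) = (Iio (s - ε)).indicator
        fun r => r ^ (β - 1) * (s - r) ^ (-β - 1) := by
      ext r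
      simp only [truncKernel, indicator_apply, mem_ofPred_eq, mem_Iio, lt_sub_iff_add_lt]
    rw [this, setIntegral_indicator measurableSet_Iio]
    have hset : Ioo 0 τ ∩ Iio (s - ε) = Ioo 0 (max (s - ε) 0) := by
      ext r
      simp only [mem_inter_iff, mem_Ioo, mem_Iio, lt_max_iff]
      constructor
      · rintro ⟨⟨h, -⟩, h'⟩; exact ⟨h, Or.inl h'⟩
      · rintro ⟨h, h' | h'⟩
        · exact ⟨⟨h, by linarith [hs.2]⟩, h'⟩
        · exact absurd h' h.not_gt
    rw [hset, integral_Ioo_rpow_mul_rpow hβ (le_max_right _ _)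
      (max_lt (by linarith) hs.1)]
    rcases le_or_gt s ε with h | h
    · rw [max_eq_right (by linarith), zero_div, Real.zero_rpow hβ0]
      ring
    · rw [max_eq_left (by linarith), sub_sub_cancel, Real.div_rpow (by linarith) hε.le,
        Real.rpow_neg hε.le]
      ring
  simp only [Pi.sub_apply, e1, e2, weylKernel]
  field_simp
  ring

/-- Fractional integration inverts fractional differentiation, in integrated form and evaluated at
the left end point. -/
lemma integral_rpow_mul_add {β τ : ℝ} (hβ : β ∈ Ioo (0 : ℝ) 1) (hτ : 0 < τ)
    {G : ℝ → ℝ} (hG : Continuous G)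
    (hint : Integrable (fun p => truncKernel β 0 p * (G p.1 - G p.2))
      ((volume.restrict (Ioo 0 τ)).prod (volume.restrict (Ioo 0 τ)))) :
    (∫ s in Ioo 0 τ, s ^ (β - 1) * (τ - s) ^ (-β) * G s) +
      β * ∫ p, truncKernel β 0 p * (G p.1 - G p.2)
        ∂(volume.restrict (Ioo 0 τ)).prod (volume.restrict (Ioo 0 τ)) =
    Real.Gamma β * Real.Gamma (1 - β) * G 0 := by
  set c := Real.Gamma β * Real.Gamma (1 - β) with hc
  have hc0 : c ≠ 0 := (mul_pos (Real.Gamma_pos_of_pos hβ.1)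
    (Real.Gamma_pos_of_pos (sub_pos.2 hβ.2))).ne'
  have hcpos : 0 < c := (mul_pos (Real.Gamma_pos_of_pos hβ.1)
    (Real.Gamma_pos_of_pos (sub_pos.2 hβ.2)))
  have hpos : ∀ᶠ ε : ℝ in 𝓝[>] 0, 0 < ε := self_mem_nhdsWithin
  -- removal of the truncation
  have limA : ∀ F : ℝ → ℝ, Continuous F → Tendsto
      (fun ε => ∫ s in Ioo 0 τ, s ^ (β - 1) * max ε (τ - s) ^ (-β) * F s) (𝓝[>] 0)
      (𝓝 (∫ s in Ioo 0 τ, s ^ (β - 1) * (τ - s) ^ (-β) * F s)) := by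
    intro F hF
    obtain ⟨C, -, hC⟩ := exists_bound_Ioo hF τ
    refine tendsto_integral_filter_of_dominated_convergence
      (fun s => s ^ (β - 1) * (τ - s) ^ (-β) * C) ?_ ?_
      ((integrableOn_rpow_mul_sub_rpow hβ hτ).mul_const C) ?_
    · exact Eventually.of_forall fun ε => by fun_prop
    · refine Eventually.of_forall fun ε => ?_
      filter_upwards [ae_restrict_mem measurableSet_Ioo] with s hs
      exact norm_rpow_mul_max_rpow_le hβ.1 hs (hC s hs)
    · filter_upwards [ae_restrict_mem measurableSet_Ioo] with s hs
      refine tendsto_const_nhds.congr' ?_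
      filter_upwards [Ioo_mem_nhdsGT (sub_pos.2 hs.2)] with ε hε
      rw [max_eq_right hε.2.le]
  have limD : Tendsto (fun ε => ∫ p, truncKernel β ε p * (G p.1 - G p.2)
        ∂(volume.restrict (Ioo 0 τ)).prod (volume.restrict (Ioo 0 τ))) (𝓝[>] 0)
      (𝓝 (∫ p, truncKernel β 0 p * (G p.1 - G p.2)
        ∂(volume.restrict (Ioo 0 τ)).prod (volume.restrict (Ioo 0 τ)))) := by
    refine tendsto_integral_filter_of_dominated_convergence
      (fun p => ‖truncKernel β 0 p * (G p.1 - G p.2)‖) ?_ ?_ hint.norm ?_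
    · refine Eventually.of_forall fun ε => ?_
      have := measurable_truncKernel β ε
      exact (this.mul (by fun_prop)).aestronglyMeasurable
    · filter_upwards [hpos] with ε hε
      refine Eventually.of_forall fun p => ?_
      rw [norm_mul, norm_mul]
      refine mul_le_mul_of_nonneg_right ?_ (norm_nonneg _)
      refine norm_indicator_le_of_subset (fun p hp => ?_) _ _
      have : p.1 + ε < p.2 := hp
      show p.1 + 0 < p.2
      linarith
    · refine Eventually.of_forall fun p => ?_
      refine tendsto_const_nhds.congr' ?_
      rcases lt_or_ge p.1 p.2 with h | h
      · filter_upwards [Ioo_mem_nhdsGT (sub_pos.2 h)] with ε hε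
        have h1 : p ∈ {p : ℝ × ℝ | p.1 + 0 < p.2} := by simpa using h
        have h2 : p ∈ {p : ℝ × ℝ | p.1 + ε < p.2} := by
          show p.1 + ε < p.2
          linarith [hε.2]
        rw [truncKernel, truncKernel, indicator_of_mem h1, indicator_of_mem h2]
      · filter_upwards [hpos] with ε hε
        have h1 : p ∉ {p : ℝ × ℝ | p.1 + 0 < p.2} := by simpa using h
        have h2 : p ∉ {p : ℝ × ℝ | p.1 + ε < p.2} := by
          show ¬ (p.1 + ε < p.2)
          linarith
        rw [truncKernel, truncKernel, indicator_of_notMem h1, indicator_of_notMem h2]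
  have lim1 : Tendsto (fun ε => ∫ s in Ioo 0 τ, weylKernel β ε s * G s) (𝓝[>] 0)
      (𝓝 ((∫ s in Ioo 0 τ, s ^ (β - 1) * (τ - s) ^ (-β) * G s) +
      β * ∫ p, truncKernel β 0 p * (G p.1 - G p.2)
        ∂(volume.restrict (Ioo 0 τ)).prod (volume.restrict (Ioo 0 τ)))) := by
    refine ((limA G hG).add (limD.const_mul β)).congr' ?_
    filter_upwards [hpos] with ε hε using integral_truncated hβ hε hτ hG
  -- the total mass of the kernel is found from the case `G = 1`
  have mass : Tendsto (fun ε => ∫ s in Ioo 0 τ, c⁻¹ * weylKernel β ε s) (𝓝[>] 0) (𝓝 1) := by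
    have h1 := (limA (fun _ => 1) continuous_const).const_mul c⁻¹
    simp only [mul_one] at h1
    rw [integral_Ioo_rpow_mul_sub_rpow hβ hτ, inv_mul_cancel₀ hc0] at h1
    refine h1.congr' ?_
    filter_upwards [hpos] with ε hε
    have := integral_truncated hβ hε hτ (G := fun _ => 1) continuous_const
    simp only [sub_self, mul_zero, integral_zero, add_zero, mul_one] at this
    rw [this, integral_const_mul]
  have lim2 : Tendsto (fun ε => ∫ s in Ioo 0 τ, (c⁻¹ * weylKernel β ε s) • G s) (𝓝[>] 0)
      (𝓝 (G 0)) := by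
    refine tendsto_setIntegral_peak_smul_of_integrableOn_of_tendsto measurableSet_Ioo
      measurableSet_Ioo subset_rfl self_mem_nhdsWithin (by simp) ?_ ?_ mass ?_
      (hG.integrableOn_Icc.mono_set Ioo_subset_Icc_self) hG.continuousWithinAt
    · filter_upwards [hpos] with ε hε s hs
      exact mul_nonneg (inv_nonneg.2 hcpos.le) (weylKernel_nonneg hβ.1 hε hs.1)
    · intro u hu h0
      obtain ⟨δ, hδ, hball⟩ := Metric.isOpen_iff.1 hu 0 h0
      have hlim : Tendsto (fun ε : ℝ => c⁻¹ * (ε ^ (1 - β) * δ ^ (β - 2))) (𝓝[>] 0) (𝓝 0) := by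
        have h1 : Tendsto (fun ε : ℝ => ε ^ (1 - β)) (𝓝[>] 0) (𝓝 (0 ^ (1 - β))) :=
          ((Real.continuousAt_rpow_const 0 (1 - β) (Or.inr (sub_pos.2 hβ.2).le)).tendsto).mono_left
            nhdsWithin_le_nhds
        rw [Real.zero_rpow (sub_pos.2 hβ.2).ne'] at h1
        simpa using (h1.mul_const (δ ^ (β - 2))).const_mul c⁻¹
      rw [Metric.tendstoUniformlyOn_iff]
      intro η hη
      filter_upwards [hlim.eventually (gt_mem_nhds hη), Ioo_mem_nhdsGT hδ] with ε h1 hε s hs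
      have hs0 : 0 < s := hs.1.1
      have hδs : δ ≤ s := by
        by_contra! hlt
        exact hs.2 (hball (by simpa [Real.norm_eq_abs, abs_of_pos hs0] using hlt))
      rw [Pi.zero_apply, dist_zero_left, Real.norm_of_nonneg
        (mul_nonneg (inv_nonneg.2 hcpos.le) (weylKernel_nonneg hβ.1 hε.1 hs0))]
      refine lt_of_le_of_lt ?_ h1
      refine mul_le_mul_of_nonneg_left ?_ (inv_nonneg.2 hcpos.le)
      refine (weylKernel_le hβ hε.1 (hε.2.le.trans hδs)).trans ?_
      exact mul_le_mul_of_nonneg_left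
        (Real.rpow_le_rpow_of_nonpos hδ hδs (by linarith [hβ.2])) (Real.rpow_nonneg hε.1.le _)
    · refine Eventually.of_forall fun ε => ?_
      unfold weylKernel
      fun_prop
  have lim3 := lim2.const_mul c
  refine tendsto_nhds_unique (lim1.congr fun ε => ?_) lim3
  rw [← integral_const_mul]
  congr 1
  ext s
  rw [smul_eq_mul]
  field_simp

/-! ### Increments and the Slobodeckij seminorm -/

/-- The square of the Slobodeckij seminorm of `g` on `(0, T)`, with kernel `|s - u| ^ (-q)`. -/
noncomputable def gagliardo (q T : ℝ) (g : ℝ → ℝ) : ℝ≥0∞ :=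
  ∫⁻ s in Ioo 0 T, ∫⁻ u in Ioo 0 T, ENNReal.ofReal ((g s - g u) ^ 2 * |s - u| ^ (-q))

/-- The mass of `|v| ^ p` on `(-T, T)`. -/
noncomputable def absPowMass (p T : ℝ) : ℝ≥0∞ := ∫⁻ v in Ioo (-T) T, ENNReal.ofReal (|v| ^ p)

lemma absPowMass_lt_top {p T : ℝ} (hp : -1 < p) : absPowMass p T < ⊤ := by
  have h1 : IntegrableOn (fun v : ℝ => |v| ^ p) (Ioo 0 T) :=
    (integrableOn_Ioo_rpow (τ := T) hp).congr_fun
      (fun v hv => by rw [abs_of_pos hv.1]) measurableSet_Ioo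
  have h2 : IntegrableOn (fun v : ℝ => |v| ^ p) (Ioo (-T) 0) := by
    have := (Measure.measurePreserving_neg (volume : Measure ℝ)).integrableOn_comp_preimage
      (MeasurableEquiv.neg ℝ).measurableEmbedding (f := fun v : ℝ => |v| ^ p) (s := Ioo 0 T)
    rw [neg_preimage, neg_Ioo, neg_zero] at this
    have h3 := this.2 h1
    simpa [Function.comp_def, abs_neg] using h3
  have h0 : IntegrableOn (fun v : ℝ => |v| ^ p) {0} :=
    (integrableOn_singleton_iff (by simp)).2 (Or.inr (by simp))
  have h4 : IntegrableOn (fun v : ℝ => |v| ^ p) (Ioo (-T) T) := by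
    refine ((h2.union h0).union h1).mono_set ?_
    intro v hv
    rcases lt_trichotomy v 0 with h | h | h
    · exact Or.inl (Or.inl ⟨hv.1, h⟩)
    · exact Or.inl (Or.inr h)
    · exact Or.inr ⟨h, hv.2⟩
  exact h4.setLIntegral_lt_top

lemma lintegral_abs_sub_rpow_le {p T s : ℝ} (hs : s ∈ Ioo 0 T) :
    ∫⁻ u in Ioo 0 T, ENNReal.ofReal (|s - u| ^ p) ≤ absPowMass p T := by
  have := (Measure.measurePreserving_sub_left (volume : Measure ℝ) s).setLIntegral_comp_preimage_emb
    (MeasurableEquiv.subLeft s).measurableEmbedding (fun v => ENNReal.ofReal (|v| ^ p))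
    (Ioo (-T) T)
  rw [absPowMass, ← this]
  refine lintegral_mono_set fun u hu => ?_
  simp only [mem_preimage, mem_Ioo] at *
  constructor <;> linarith [hs.1, hs.2, hu.1, hu.2]

/-- The inequality `x y ≤ x² + y²`, with the weight split between the two factors. -/
lemma mul_abs_mul_rpow_le (w d v p q : ℝ) (hv : 0 ≤ v) (h : v = 0 → d = 0) :
    w * |d| * v ^ p ≤ d ^ 2 * v ^ (-q) + w ^ 2 * v ^ (q + 2 * p) := by
  rcases hv.eq_or_lt with h0 | h0
  · rw [h h0.symm]
    simp only [abs_zero, mul_zero, zero_mul, ne_eq, OfNat.ofNat_ne_zero, not_false_eq_true,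
      zero_pow, zero_add]
    positivity
  · have e1 : v ^ (-q) = (v ^ (-q / 2)) ^ 2 := by
      rw [← Real.rpow_natCast, ← Real.rpow_mul h0.le]
      congr 1
      push_cast
      ring
    have e2 : v ^ (q + 2 * p) = (v ^ (q / 2 + p)) ^ 2 := by
      rw [← Real.rpow_natCast, ← Real.rpow_mul h0.le]
      congr 1
      push_cast
      ring
    have e3 : v ^ p = v ^ (-q / 2) * v ^ (q / 2 + p) := by
      rw [← Real.rpow_add h0]
      congr 1
      ring
    rw [e1, e2, e3, ← sq_abs d]
    nlinarith [sq_nonneg (|d| * v ^ (-q / 2) - w * v ^ (q / 2 + p)),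
      sq_nonneg (|d| * v ^ (-q / 2)), sq_nonneg (w * v ^ (q / 2 + p))]

/-- A weighted increment integral is controlled by the Slobodeckij seminorm. -/
lemma lintegral_weight_mul_abs_sub_le (p q T : ℝ) {g w : ℝ → ℝ} (hg : Measurable g)
    (hw : Measurable w) :
    ∫⁻ s in Ioo 0 T, ∫⁻ u in Ioo 0 T, ENNReal.ofReal (w s * |g s - g u| * |s - u| ^ p) ≤
      gagliardo q T g + (∫⁻ s in Ioo 0 T, ENNReal.ofReal (w s ^ 2)) * absPowMass (q + 2 * p) T := by
  rw [gagliardo, ← lintegral_mul_const _ (by fun_prop), ← lintegral_add_left ?_]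
  swap
  · refine Measurable.lintegral_prod_right (f := fun s u =>
      ENNReal.ofReal ((g s - g u) ^ 2 * |s - u| ^ (-q))) ?_
    unfold Function.uncurry
    fun_prop
  refine setLIntegral_mono' measurableSet_Ioo fun s hs => ?_
  calc ∫⁻ u in Ioo 0 T, ENNReal.ofReal (w s * |g s - g u| * |s - u| ^ p)
      ≤ ∫⁻ u in Ioo 0 T, (ENNReal.ofReal ((g s - g u) ^ 2 * |s - u| ^ (-q)) +
          ENNReal.ofReal (w s ^ 2) * ENNReal.ofReal (|s - u| ^ (q + 2 * p))) := by
        refine lintegral_mono fun u => ?_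
        rw [← ENNReal.ofReal_mul (sq_nonneg _), ← ENNReal.ofReal_add (by positivity) (by positivity)]
        refine ENNReal.ofReal_le_ofReal (mul_abs_mul_rpow_le _ _ _ _ _ (abs_nonneg _) ?_)
        intro h
        rw [abs_eq_zero, sub_eq_zero] at h
        rw [h, sub_self]
    _ = (∫⁻ u in Ioo 0 T, ENNReal.ofReal ((g s - g u) ^ 2 * |s - u| ^ (-q))) +
          ENNReal.ofReal (w s ^ 2) * ∫⁻ u in Ioo 0 T, ENNReal.ofReal (|s - u| ^ (q + 2 * p)) := by
        rw [lintegral_add_left (by fun_prop), lintegral_const_mul _ (by fun_prop)]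
    _ ≤ _ := by
        gcongr
        exact lintegral_abs_sub_rpow_le hs

lemma gagliardo_comp_le {q T τ : ℝ} {g φ : ℝ → ℝ}
    (hφ : MeasurePreserving φ (volume : Measure ℝ) volume) (hφe : MeasurableEmbedding φ)
    (hiso : ∀ s u, |φ s - φ u| = |s - u|) (hmaps : MapsTo φ (Ioo 0 τ) (Ioo 0 T)) :
    gagliardo q τ (g ∘ φ) ≤ gagliardo q T g := by
  have e : ∀ F : ℝ → ℝ≥0∞, ∫⁻ s in Ioo 0 τ, F (φ s) ≤ ∫⁻ s in Ioo 0 T, F s := fun F => by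
    rw [← hφ.setLIntegral_comp_preimage_emb hφe F (Ioo 0 T)]
    exact lintegral_mono_set (show Ioo 0 τ ⊆ φ ⁻¹' Ioo 0 T from hmaps)
  calc gagliardo q τ (g ∘ φ)
      ≤ ∫⁻ s in Ioo 0 τ, ∫⁻ u in Ioo 0 T,
          ENNReal.ofReal ((g (φ s) - g u) ^ 2 * |φ s - u| ^ (-q)) := by
        refine lintegral_mono fun s => ?_
        refine le_trans (le_of_eq (lintegral_congr fun u => ?_))
          (e fun u => ENNReal.ofReal ((g (φ s) - g u) ^ 2 * |φ s - u| ^ (-q)))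
        rw [hiso, Function.comp_apply, Function.comp_apply]
    _ ≤ _ := e fun s => ∫⁻ u in Ioo 0 T, ENNReal.ofReal ((g s - g u) ^ 2 * |s - u| ^ (-q))

lemma gagliardo_comp_add_le {q T τ u : ℝ} {g : ℝ → ℝ} (hu : 0 ≤ u) (h : u + τ ≤ T) :
    gagliardo q τ (fun s => g (u + s)) ≤ gagliardo q T g := by
  refine gagliardo_comp_le (φ := fun s => u + s) (measurePreserving_add_left volume u)
    (MeasurableEquiv.addLeft u).measurableEmbedding (fun s r => by congr 1; ring) ?_
  intro s hs
  simp only [mem_Ioo] at *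
  constructor <;> linarith [hs.1, hs.2]

lemma gagliardo_comp_sub_le {q T t : ℝ} {g : ℝ → ℝ} (h : t ≤ T) :
    gagliardo q t (fun s => g (t - s)) ≤ gagliardo q T g := by
  refine gagliardo_comp_le (φ := fun s => t - s) (Measure.measurePreserving_sub_left volume t)
    (MeasurableEquiv.subLeft t).measurableEmbedding
    (fun s r => by rw [abs_sub_comm s r]; congr 1; ring) ?_
  intro s hs
  simp only [mem_Ioo] at *
  constructor <;> linarith [hs.1, hs.2]

/-- The bound for the weighted increments in the inversion formula: the Slobodeckij seminorm plus
a constant depending only on `T`. -/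
lemma lintegral_truncKernel_le {β q T τ : ℝ} (hT : τ ≤ T) {G : ℝ → ℝ} (hG : Continuous G) :
    ∫⁻ p, ‖truncKernel β 0 p * (G p.1 - G p.2)‖ₑ
        ∂(volume.restrict (Ioo 0 τ)).prod (volume.restrict (Ioo 0 τ)) ≤
      gagliardo q τ G + (∫⁻ s in Ioo 0 T, ENNReal.ofReal (s ^ (2 * β - 2))) *
        absPowMass (q - 2 * β - 2) T := by
  have hm : Measurable fun p : ℝ × ℝ => truncKernel β 0 p * (G p.1 - G p.2) :=
    (measurable_truncKernel β 0).mul (by fun_prop)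
  rw [lintegral_prod _ hm.enorm.aemeasurable]
  calc ∫⁻ s in Ioo 0 τ, ∫⁻ r in Ioo 0 τ, ‖truncKernel β 0 (s, r) * (G s - G r)‖ₑ
      ≤ ∫⁻ s in Ioo 0 τ, ∫⁻ u in Ioo 0 τ,
          ENNReal.ofReal (s ^ (β - 1) * |G s - G u| * |s - u| ^ (-β - 1)) := by
        refine setLIntegral_mono' measurableSet_Ioo fun s hs => lintegral_mono fun r => ?_
        rw [← ofReal_norm]
        refine ENNReal.ofReal_le_ofReal ?_
        have h1 : 0 ≤ s ^ (β - 1) := Real.rpow_nonneg hs.1.le _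
        rw [truncKernel, indicator_apply]
        split_ifs with h
        · have h' : 0 < r - s := by have : s + 0 < r := h; linarith
          rw [norm_mul, norm_mul, Real.norm_of_nonneg h1, Real.norm_of_nonneg
            (Real.rpow_nonneg h'.le _), abs_sub_comm s r, abs_of_pos h', Real.norm_eq_abs]
          exact le_of_eq (by ring)
        · rw [zero_mul, norm_zero]
          positivity
    _ ≤ gagliardo q τ G + (∫⁻ s in Ioo 0 τ, ENNReal.ofReal ((s ^ (β - 1)) ^ 2)) *
          absPowMass (q + 2 * (-β - 1)) τ :=
        lintegral_weight_mul_abs_sub_le (w := fun s => s ^ (β - 1)) _ _ _ hG.measurable (by fun_prop)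
    _ ≤ _ := by
        refine add_le_add le_rfl (mul_le_mul' ?_ ?_)
        · refine (lintegral_mono_set (Ioo_subset_Ioo_right hT)).trans (le_of_eq ?_)
          refine setLIntegral_congr_fun measurableSet_Ioo fun s hs => ?_
          rw [← Real.rpow_natCast, ← Real.rpow_mul hs.1.le]
          congr 2
          push_cast
          ring
        · rw [show q + 2 * (-β - 1) = q - 2 * β - 2 by ring]
          exact lintegral_mono_set (Ioo_subset_Ioo (by linarith) hT)

/-- The constant in `lintegral_truncKernel_le`. -/
noncomputable def incrementConst (β q T : ℝ) : ℝ≥0∞ :=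
  (∫⁻ s in Ioo 0 T, ENNReal.ofReal (s ^ (2 * β - 2))) * absPowMass (q - 2 * β - 2) T

lemma incrementConst_lt_top {β q T : ℝ} (hβ : 1 / 2 < β) (hq : 2 * β + 1 < q) :
    incrementConst β q T < ⊤ :=
  ENNReal.mul_lt_top (integrableOn_Ioo_rpow (by linarith)).setLIntegral_lt_top
    (absPowMass_lt_top (by linarith))

lemma integrable_truncKernel_mul_sub {β q τ : ℝ} (hβ : 1 / 2 < β) (hq : 2 * β + 1 < q)
    {G : ℝ → ℝ} (hG : Continuous G) (hE : gagliardo q τ G < ⊤) :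
    Integrable (fun p => truncKernel β 0 p * (G p.1 - G p.2))
      ((volume.restrict (Ioo 0 τ)).prod (volume.restrict (Ioo 0 τ))) := by
  refine ⟨((measurable_truncKernel β 0).mul (by fun_prop)).aestronglyMeasurable, ?_⟩
  exact (lintegral_truncKernel_le (q := q) le_rfl hG).trans_lt
    (ENNReal.add_lt_top.2 ⟨hE, incrementConst_lt_top hβ hq⟩)

lemma rpow_mul_rightWeyl_eq {β τ s : ℝ} (hs : s ∈ Ioo 0 τ) (G : ℝ → ℝ) :
    s ^ (β - 1) * rightWeyl β τ G s = (Real.Gamma (1 - β))⁻¹ *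
      (s ^ (β - 1) * (τ - s) ^ (-β) * G s +
        β * ∫ r in Ioo 0 τ, truncKernel β 0 (s, r) * (G s - G r)) := by
  have h1 : ∫ r in Ioo 0 τ, truncKernel β 0 (s, r) * (G s - G r) =
      s ^ (β - 1) * ∫ r in s..τ, (G s - G r) / (r - s) ^ (β + 1) := by
    have e : (fun r => truncKernel β 0 (s, r) * (G s - G r)) = (Ioi s).indicator
        fun r => s ^ (β - 1) * ((r - s) ^ (-β - 1) * (G s - G r)) := by
      ext r
      simp only [truncKernel, indicator_apply, mem_ofPred_eq, add_zero, mem_Ioi]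
      split_ifs <;> ring
    have hset : Ioo 0 τ ∩ Ioi s = Ioo s τ := by
      ext r
      simp only [mem_inter_iff, mem_Ioo, mem_Ioi]
      constructor
      · rintro ⟨⟨-, h⟩, h'⟩; exact ⟨h', h⟩
      · rintro ⟨h', h⟩; exact ⟨⟨hs.1.trans h', h⟩, h'⟩
    rw [e, setIntegral_indicator measurableSet_Ioi, hset, integral_const_mul,
      intervalIntegral.integral_of_le hs.2.le, integral_Ioc_eq_integral_Ioo]
    congr 1
    refine setIntegral_congr_fun measurableSet_Ioo fun r hr => ?_
    have : 0 ≤ r - s := sub_nonneg.2 hr.1.le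
    rw [show -β - 1 = -(β + 1) by ring, Real.rpow_neg this, div_eq_inv_mul]
  rw [h1, rightWeyl, Real.rpow_neg (sub_nonneg.2 hs.2.le)]
  ring

section Inversion

variable {β q τ : ℝ} {G : ℝ → ℝ}

lemma integrableOn_rpow_mul_sub_rpow_mul (hβ : β ∈ Ioo (0 : ℝ) 1) (hτ : 0 < τ)
    (hG : Continuous G) :
    IntegrableOn (fun s => s ^ (β - 1) * (τ - s) ^ (-β) * G s) (Ioo 0 τ) := by
  obtain ⟨C, -, hC⟩ := exists_bound_Ioo hG τ
  refine (integrableOn_rpow_mul_sub_rpow hβ hτ).mul_bdd (c := C) (by fun_prop) ?_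
  filter_upwards [ae_restrict_mem measurableSet_Ioo] with s hs using hC s hs

lemma integrableOn_rpow_mul_rightWeyl (hβ : β ∈ Ioo (1 / 2 : ℝ) 1) (hq : 2 * β + 1 < q)
    (hτ : 0 < τ) (hG : Continuous G) (hE : gagliardo q τ G < ⊤) :
    IntegrableOn (fun s => s ^ (β - 1) * rightWeyl β τ G s) (Ioo 0 τ) := by
  have hβ' : β ∈ Ioo (0 : ℝ) 1 := ⟨by linarith [hβ.1], hβ.2⟩
  have h1 := (integrable_truncKernel_mul_sub hβ.1 hq hG hE).integral_prod_left
  refine IntegrableOn.congr_fun (((integrableOn_rpow_mul_sub_rpow_mul hβ' hτ hG).add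
    (h1.const_mul β)).const_mul (Real.Gamma (1 - β))⁻¹) (fun s hs => ?_) measurableSet_Ioo
  exact (rpow_mul_rightWeyl_eq hs G).symm

/-- The fractional integral of order `β` inverts the right Weyl derivative of order `β`. -/
lemma integral_rpow_mul_rightWeyl (hβ : β ∈ Ioo (1 / 2 : ℝ) 1) (hq : 2 * β + 1 < q)
    (hτ : 0 < τ) (hG : Continuous G) (hE : gagliardo q τ G < ⊤) :
    ∫ s in Ioo 0 τ, s ^ (β - 1) * rightWeyl β τ G s = Real.Gamma β * G 0 := by
  have hβ' : β ∈ Ioo (0 : ℝ) 1 := ⟨by linarith [hβ.1], hβ.2⟩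
  have hint := integrable_truncKernel_mul_sub hβ.1 hq hG hE
  have h2 := integral_rpow_mul_add hβ' hτ hG hint
  rw [integral_prod _ hint, ← integral_const_mul] at h2
  have h3 : (∫ s in Ioo 0 τ, (s ^ (β - 1) * (τ - s) ^ (-β) * G s +
      β * ∫ r in Ioo 0 τ, truncKernel β 0 (s, r) * (G s - G r))) =
      Real.Gamma β * Real.Gamma (1 - β) * G 0 := by
    rw [← h2]
    exact integral_add (integrableOn_rpow_mul_sub_rpow_mul hβ' hτ hG)
      (hint.integral_prod_left.const_mul β)
  rw [setIntegral_congr_fun measurableSet_Ioo fun s hs => rpow_mul_rightWeyl_eq hs G,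
    integral_const_mul, h3]
  have : Real.Gamma (1 - β) ≠ 0 := (Real.Gamma_pos_of_pos (sub_pos.2 hβ.2)).ne'
  field_simp

lemma rightWeyl_comp_add (β t u s : ℝ) (G : ℝ → ℝ) :
    rightWeyl β (t - u) (fun r => G (u + r)) s = rightWeyl β t G (u + s) := by
  rw [rightWeyl, rightWeyl, show t - u - s = t - (u + s) by ring]
  congr 3
  have := intervalIntegral.integral_comp_add_left
    (fun r => (G (u + s) - G r) / (r - (u + s)) ^ (β + 1)) (a := s) (b := t - u) u
  rw [show u + (t - u) = t by ring] at this
  rw [← this]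
  refine intervalIntegral.integral_congr fun r _ => ?_
  congr 2
  ring

/-- `integral_rpow_mul_rightWeyl`, on the interval `(u, t)`. -/
lemma integral_sub_rpow_mul_rightWeyl {u t T : ℝ} (hβ : β ∈ Ioo (1 / 2 : ℝ) 1)
    (hq : 2 * β + 1 < q) (hu : 0 ≤ u) (hut : u < t) (htT : t ≤ T) (hG : Continuous G)
    (hE : gagliardo q T G < ⊤) :
    ∫ s in Ioo u t, (s - u) ^ (β - 1) * rightWeyl β t G s = Real.Gamma β * G u := by
  have h := integral_rpow_mul_rightWeyl (G := fun r => G (u + r)) (τ := t - u) hβ hq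
    (sub_pos.2 hut) (by fun_prop) ((gagliardo_comp_add_le hu (by linarith)).trans_lt hE)
  simp only [rightWeyl_comp_add, add_zero] at h
  rw [← h, ← integral_Ioc_eq_integral_Ioo, ← integral_Ioc_eq_integral_Ioo,
    ← intervalIntegral.integral_of_le hut.le, ← intervalIntegral.integral_of_le (sub_pos.2 hut).le]
  have := intervalIntegral.integral_comp_add_left
    (fun s => (s - u) ^ (β - 1) * rightWeyl β t G s) (a := 0) (b := t - u) u
  rw [show u + (t - u) = t by ring, add_zero] at this
  rw [← this]
  simp only [add_sub_cancel_left]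

end Inversion

/-! ### The energy of a path -/

/-- The energy controlling a path on `(0, T)`: the square of the Slobodeckij seminorm, plus a
weighted `L²`-norm that keeps track of the behaviour at `0`. -/
noncomputable def pathEnergy (β q T : ℝ) (g : ℝ → ℝ) : ℝ≥0∞ :=
  gagliardo q T g + ∫⁻ s in Ioo 0 T, ENNReal.ofReal (g s ^ 2 * s ^ (-(2 * β)))

lemma pathEnergy_const_mul (β q T c : ℝ) (g : ℝ → ℝ) :
    pathEnergy β q T (fun s => c * g s) = ENNReal.ofReal (c ^ 2) * pathEnergy β q T g := by
  unfold pathEnergy gagliardo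
  rw [mul_add, ← lintegral_const_mul' _ _ ENNReal.ofReal_ne_top,
    ← lintegral_const_mul' _ _ ENNReal.ofReal_ne_top]
  congr 1
  · refine lintegral_congr fun s => ?_
    rw [← lintegral_const_mul' _ _ ENNReal.ofReal_ne_top]
    refine lintegral_congr fun u => ?_
    rw [← ENNReal.ofReal_mul (sq_nonneg c)]
    congr 1
    ring
  · refine lintegral_congr fun s => ?_
    rw [← ENNReal.ofReal_mul (sq_nonneg c)]
    congr 1
    ring

/-- A path of finite energy is bounded; this is the inversion formula for the reversed path,
with all integrands estimated by `x y ≤ x² + y²`. -/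
lemma abs_le_of_pathEnergy_le_one {β q T : ℝ} (hβ : β ∈ Ioo (1 / 2 : ℝ) 1) (hq : 2 * β + 1 < q) :
    ∃ C, 0 ≤ C ∧ ∀ g : ℝ → ℝ, Continuous g → pathEnergy β q T g ≤ 1 →
      ∀ t ∈ Ioc 0 T, |g t| ≤ C := by
  have hβ' : β ∈ Ioo (0 : ℝ) 1 := ⟨by linarith [hβ.1], hβ.2⟩
  set c := Real.Gamma β * Real.Gamma (1 - β)
  have hc : 0 < c := mul_pos (Real.Gamma_pos_of_pos hβ'.1)
    (Real.Gamma_pos_of_pos (sub_pos.2 hβ.2))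
  set J := ∫⁻ s in Ioo 0 T, ENNReal.ofReal (s ^ (2 * β - 2)) with hJ
  have hJtop : J < ⊤ := (integrableOn_Ioo_rpow (by linarith [hβ.1])).setLIntegral_lt_top
  have hI := incrementConst_lt_top (T := T) hβ.1 hq
  set K := (J + 1) + ENNReal.ofReal β * (1 + incrementConst β q T) with hK
  have hKtop : K < ⊤ := ENNReal.add_lt_top.2 ⟨ENNReal.add_lt_top.2 ⟨hJtop, ENNReal.one_lt_top⟩,
    ENNReal.mul_lt_top ENNReal.ofReal_lt_top (ENNReal.add_lt_top.2 ⟨ENNReal.one_lt_top, hI⟩)⟩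
  refine ⟨c⁻¹ * K.toReal, by positivity, fun g hg hE t ht => ?_⟩
  have hgag : gagliardo q t (fun s => g (t - s)) ≤ 1 :=
    (gagliardo_comp_sub_le ht.2).trans (le_self_add.trans hE)
  have hG : Continuous fun s => g (t - s) := by fun_prop
  have key := integral_rpow_mul_add hβ' ht.1 hG
    (integrable_truncKernel_mul_sub hβ.1 hq hG (hgag.trans_lt ENNReal.one_lt_top))
  rw [sub_zero] at key
  have b1 : ‖∫ s in Ioo 0 t, s ^ (β - 1) * (t - s) ^ (-β) * g (t - s)‖ₑ ≤ J + 1 := by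
    refine (enorm_integral_le_lintegral_enorm _).trans ?_
    calc ∫⁻ s in Ioo 0 t, ‖s ^ (β - 1) * (t - s) ^ (-β) * g (t - s)‖ₑ
        ≤ ∫⁻ s in Ioo 0 t, (ENNReal.ofReal (s ^ (2 * β - 2)) +
            ENNReal.ofReal (g (t - s) ^ 2 * (t - s) ^ (-(2 * β)))) := by
          refine setLIntegral_mono' measurableSet_Ioo fun s hs => ?_
          have hts : 0 < t - s := sub_pos.2 hs.2
          have h2 : 0 ≤ g (t - s) ^ 2 * (t - s) ^ (-(2 * β)) :=
            mul_nonneg (sq_nonneg _) (Real.rpow_nonneg hts.le _)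
          rw [← ofReal_norm, ← ENNReal.ofReal_add (Real.rpow_nonneg hs.1.le _) h2]
          refine ENNReal.ofReal_le_ofReal ?_
          have e1 : s ^ (2 * β - 2) = (s ^ (β - 1)) ^ 2 := by
            rw [← Real.rpow_natCast, ← Real.rpow_mul hs.1.le]
            congr 1
            push_cast
            ring
          have e2 : (t - s) ^ (-(2 * β)) = ((t - s) ^ (-β)) ^ 2 := by
            rw [← Real.rpow_natCast, ← Real.rpow_mul hts.le]
            congr 1
            push_cast
            ring
          rw [e1, e2, Real.norm_eq_abs, abs_le]
          constructor <;>
            nlinarith [sq_nonneg (s ^ (β - 1) + (t - s) ^ (-β) * g (t - s)),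
              sq_nonneg (s ^ (β - 1) - (t - s) ^ (-β) * g (t - s)),
              sq_nonneg (s ^ (β - 1)), sq_nonneg ((t - s) ^ (-β) * g (t - s))]
      _ = (∫⁻ s in Ioo 0 t, ENNReal.ofReal (s ^ (2 * β - 2))) +
            ∫⁻ s in Ioo 0 t, ENNReal.ofReal (g (t - s) ^ 2 * (t - s) ^ (-(2 * β))) :=
          lintegral_add_left (by fun_prop) _
      _ ≤ J + 1 := by
          refine add_le_add (lintegral_mono_set (Ioo_subset_Ioo_right ht.2)) ?_
          refine le_trans ?_ (le_add_self.trans hE)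
          rw [← (Measure.measurePreserving_sub_left volume t).setLIntegral_comp_preimage_emb
            (MeasurableEquiv.subLeft t).measurableEmbedding
            (fun s => ENNReal.ofReal (g s ^ 2 * s ^ (-(2 * β)))) (Ioo 0 T)]
          refine lintegral_mono_set fun s hs => ?_
          simp only [mem_preimage, mem_Ioo] at *
          constructor <;> linarith [hs.1, hs.2, ht.2]
  have b2 : ‖∫ p, truncKernel β 0 p * (g (t - p.1) - g (t - p.2))
      ∂(volume.restrict (Ioo 0 t)).prod (volume.restrict (Ioo 0 t))‖ₑ ≤
      1 + incrementConst β q T :=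
    (enorm_integral_le_lintegral_enorm _).trans
      ((lintegral_truncKernel_le (q := q) ht.2 hG).trans (add_le_add hgag le_rfl))
  have b3 : ‖c * g t‖ₑ ≤ K := by
    rw [← key]
    refine (enorm_add_le _ _).trans (add_le_add b1 ?_)
    rw [enorm_mul]
    refine mul_le_mul' ?_ b2
    rw [← ofReal_norm, Real.norm_of_nonneg hβ'.1.le]
  have b4 : |c * g t| ≤ K.toReal := by
    have := ENNReal.toReal_mono hKtop.ne b3
    rwa [toReal_enorm, Real.norm_eq_abs] at this
  rw [abs_mul, abs_of_pos hc] at b4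
  rw [inv_mul_eq_div, le_div_iff₀ hc]
  linarith

/-- The supremum of a path is controlled by its energy. -/
lemma sq_le_pathEnergy {β q T : ℝ} (hβ : β ∈ Ioo (1 / 2 : ℝ) 1) (hq : 2 * β + 1 < q) :
    ∃ C, 0 ≤ C ∧ ∀ g : ℝ → ℝ, Continuous g → pathEnergy β q T g < ⊤ →
      ∀ t ∈ Ioc 0 T, g t ^ 2 ≤ C * (1 + (pathEnergy β q T g).toReal) := by
  obtain ⟨C, hC0, hC⟩ := abs_le_of_pathEnergy_le_one (T := T) hβ hq
  refine ⟨C ^ 2, sq_nonneg C, fun g hg hE t ht => ?_⟩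
  -- both sides are quadratic in `g`, so the path may be scaled to have energy at most one
  set E := (pathEnergy β q T g).toReal with hEdef
  have hE0 : 0 ≤ E := ENNReal.toReal_nonneg
  set r := √(1 + E)
  have hr : 0 < r := Real.sqrt_pos.2 (by linarith)
  have hr2 : r ^ 2 = 1 + E := Real.sq_sqrt (by linarith)
  have h1 := hC (fun s => r⁻¹ * g s) (by fun_prop) (by
    rw [pathEnergy_const_mul, ← ENNReal.ofReal_toReal hE.ne, ← hEdef,
      ← ENNReal.ofReal_mul (sq_nonneg _), ENNReal.ofReal_le_one, inv_pow, hr2,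
      inv_mul_le_iff₀ (by linarith)]
    linarith) t ht
  rw [abs_mul, abs_of_pos (inv_pos.2 hr), inv_mul_le_iff₀ hr] at h1
  rw [← sq_abs, ← hr2, ← mul_pow, mul_comm C]
  exact pow_le_pow_left₀ (abs_nonneg _) h1 2

/-! ### Integration by parts in the generalized Stieltjes integral -/

/-- For a continuously differentiable function the left Weyl derivative is the fractional integral
of the derivative, with a term for the initial value. -/
lemma leftWeyl_eq_of_hasDerivAt {α s : ℝ} (hα : α ∈ Ioo (0 : ℝ) 1) (hs : 0 < s) {f f' : ℝ → ℝ}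
    (hf : ∀ u, HasDerivAt f (f' u) u) (hf' : Continuous f') :
    leftWeyl α f s = (Real.Gamma (1 - α))⁻¹ *
      (f 0 * s ^ (-α) + ∫ u in Ioo 0 s, (s - u) ^ (-α) * f' u) := by
  have hpow : IntervalIntegrable (fun u => (s - u) ^ (-α)) volume 0 s := by
    have := (intervalIntegral.intervalIntegrable_rpow' (a := 0) (b := s) (r := -α)
      (by linarith [hα.2])).comp_sub_left s
    simpa using this.symm
  have i1 : IntervalIntegrable (fun u => (s - u) ^ (-α) * f' u) volume 0 s :=
    hpow.mul_continuousOn hf'.continuousOn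
  -- the difference quotient of `f` at `s`, extended continuously to the diagonal
  have hd : Continuous (dslope f s) := by
    rw [continuous_iff_continuousAt]
    intro u
    rcases eq_or_ne u s with rfl | h
    · exact continuousAt_dslope_same.2 (hf u).differentiableAt
    · exact (continuousAt_dslope_of_ne h).2 (hf u).continuousAt
  have hds : ∀ u, f s - f u = (s - u) * dslope f s u := fun u => by
    have := sub_smul_dslope f s u
    rw [smul_eq_mul] at this
    linarith
  have i2 : IntervalIntegrable (fun u => (s - u) ^ (-α) * dslope f s u) volume 0 s :=
    hpow.mul_continuousOn hd.continuousOn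
  have i3 : IntervalIntegrable (fun u => (s - u) ^ (-α - 1) * (f s - f u)) volume 0 s := by
    refine i2.congr_ae ?_
    rw [uIoc_of_le hs.le, ← restrict_Ioo_eq_restrict_Ioc]
    filter_upwards [ae_restrict_mem measurableSet_Ioo] with u hu
    have hsu : 0 < s - u := sub_pos.2 hu.2
    rw [hds, Real.rpow_sub_one hsu.ne']
    field_simp
  have key := intervalIntegral.integral_eq_sub_of_hasDerivAt_of_le
    (f := fun u => (s - u) ^ (1 - α) * dslope f s u)
    (f' := fun u => α * ((s - u) ^ (-α - 1) * (f s - f u)) - (s - u) ^ (-α) * f' u) hs.le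
    ?_ ?_ ((i3.const_mul α).sub i1)
  · rw [intervalIntegral.integral_sub (i3.const_mul α) i1, intervalIntegral.integral_const_mul]
      at key
    rw [leftWeyl, smul_eq_mul, smul_eq_mul, smul_eq_mul]
    have e1 : ∫ u in (0 : ℝ)..s, ((s - u) ^ (α + 1))⁻¹ • (f s - f u) =
        ∫ u in (0 : ℝ)..s, (s - u) ^ (-α - 1) * (f s - f u) := by
      refine intervalIntegral.integral_congr fun u hu => ?_
      rw [uIcc_of_le hs.le] at hu
      simp only [smul_eq_mul]
      rw [← Real.rpow_neg (sub_nonneg.2 hu.2), neg_add']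
    have e2 : (s - 0) ^ (1 - α) * dslope f s 0 = s ^ (-α) * (f s - f 0) := by
      rw [hds 0, sub_zero, show 1 - α = -α + 1 by ring, Real.rpow_add_one hs.ne']
      ring
    simp only [sub_self, Real.zero_rpow (sub_pos.2 hα.2).ne', zero_mul, zero_sub] at key
    rw [e2] at key
    rw [e1, ← Real.rpow_neg hs.le, ← integral_Ioc_eq_integral_Ioo,
      ← intervalIntegral.integral_of_le hs.le]
    congr 1
    linarith
  · exact ((continuousOn_const.sub continuousOn_id).rpow_const
      fun u _ => Or.inr (sub_pos.2 hα.2).le).mul hd.continuousOn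
  · intro u hu
    have hsu : 0 < s - u := sub_pos.2 hu.2
    have h1 : HasDerivAt (fun u => (s - u) ^ (-α) * (f s - f u))
        (α * ((s - u) ^ (-α - 1) * (f s - f u)) - (s - u) ^ (-α) * f' u) u := by
      have h2 := (((hasDerivAt_id u).const_sub s).rpow_const (p := -α) (Or.inl hsu.ne')).mul
        ((hf u).const_sub (f s))
      refine h2.congr_deriv ?_
      simp only [id]
      ring
    refine h1.congr_of_eventuallyEq ?_
    filter_upwards [Iio_mem_nhds hu.2] with v hv
    have hsv : 0 < s - v := sub_pos.2 hv
    rw [hds v, show 1 - α = -α + 1 by ring, Real.rpow_add_one hsv.ne']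
    ring

/-- Integrability in the plane of `R s * (s - u) ^ (β - 1)`, an integrand of convolution type. The
first coordinate of `p` is `u` and the second is `s`. -/
lemma integrable_convolution_rpow {β t : ℝ} (hβ : 0 < β) {R : ℝ → ℝ}
    (hR : IntegrableOn R (Ioo 0 t)) :
    Integrable (fun p : ℝ × ℝ => (Ioo 0 t).indicator R p.2 *
      (Ioo 0 t).indicator (fun v => v ^ (β - 1)) (p.2 - p.1)) (volume.prod volume) := by
  have h1 : Integrable ((Ioo 0 t).indicator R) := hR.integrable_indicator measurableSet_Ioo
  have h2 : Integrable ((Ioo 0 t).indicator fun v : ℝ => v ^ (β - 1)) :=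
    (integrableOn_Ioo_rpow (by linarith)).integrable_indicator measurableSet_Ioo
  have h3 := Integrable.convolution_integrand (ContinuousLinearMap.mul ℝ ℝ) h1 h2.comp_neg
  simpa using h3

/-- Integration by parts: against a continuously differentiable integrand, the generalized
Stieltjes integral is a Lebesgue integral. -/
lemma genStieltjes_eq_of_hasDerivAt {α q t T : ℝ} (hα : α ∈ Ioo (0 : ℝ) (1 / 2))
    (hq : 2 * (1 - α) + 1 < q) (ht : 0 < t) (htT : t ≤ T) {g f f' : ℝ → ℝ} (hg : Continuous g)
    (hE : gagliardo q T g < ⊤) (hf : ∀ u, HasDerivAt f (f' u) u) (hf' : Continuous f') :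
    genStieltjes α t f g = f t * g t - f 0 * g 0 - ∫ s in (0 : ℝ)..t, f' s * g s := by
  set β := 1 - α with hβdef
  have hβ : β ∈ Ioo (1 / 2 : ℝ) 1 := ⟨by linarith [hα.2], by linarith [hα.1]⟩
  have hα1 : 1 - α = β := rfl
  have hΓ : Real.Gamma β ≠ 0 := (Real.Gamma_pos_of_pos (by linarith [hβ.1])).ne'
  set G : ℝ → ℝ := fun r => g r - g t with hGdef
  have hG : Continuous G := by fun_prop
  have hEG : gagliardo q T G < ⊤ := by
    simpa only [gagliardo, hGdef, sub_sub_sub_cancel_right] using hE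
  have hEt : gagliardo q t G < ⊤ := by
    have := gagliardo_comp_add_le (q := q) (T := T) (τ := t) (u := 0) (g := G) le_rfl (by linarith)
    simp only [zero_add] at this
    exact this.trans_lt hEG
  set R := rightWeyl β t G with hRdef
  have hR1 : IntegrableOn (fun s => s ^ (β - 1) * R s) (Ioo 0 t) :=
    integrableOn_rpow_mul_rightWeyl hβ hq ht hG hEt
  have hR : IntegrableOn R (Ioo 0 t) := by
    have h1 : IntegrableOn (fun s => s ^ (1 - β) * (s ^ (β - 1) * R s)) (Ioo 0 t) := by
      refine hR1.bdd_mul (c := t ^ (1 - β)) (by fun_prop) ?_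
      filter_upwards [ae_restrict_mem measurableSet_Ioo] with s hs
      rw [Real.norm_of_nonneg (Real.rpow_nonneg hs.1.le _)]
      exact Real.rpow_le_rpow hs.1.le hs.2.le (by linarith [hβ.2])
    refine h1.congr_fun (fun s hs => ?_) measurableSet_Ioo
    simp only
    rw [← mul_assoc, ← Real.rpow_add hs.1, show 1 - β + (β - 1) = 0 by ring, Real.rpow_zero,
      one_mul]
  -- the double integral
  set F : ℝ → ℝ := (Ioo 0 t).indicator f' with hFdef
  obtain ⟨C, hC0, hC⟩ := exists_bound_Ioo hf' t
  have hFm : Measurable F := hf'.measurable.indicator measurableSet_Ioo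
  have hKint : Integrable (fun p : ℝ × ℝ => (Ioo 0 t).indicator R p.2 *
      (Ioo 0 t).indicator (fun v => v ^ (β - 1)) (p.2 - p.1) * F p.1) (volume.prod volume) := by
    refine (integrable_convolution_rpow (by linarith [hβ.1]) hR).mul_bdd (c := C)
      (hFm.comp measurable_fst).aestronglyMeasurable (Eventually.of_forall fun p => ?_)
    rw [hFdef, indicator_apply]
    split_ifs with h
    · exact hC _ h
    · simpa using hC0
  have inner : ∀ s, ∫ u, (Ioo 0 t).indicator R s *
      (Ioo 0 t).indicator (fun v => v ^ (β - 1)) (s - u) * F u =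
      (Ioo 0 t).indicator (fun s => R s * ∫ u in Ioo 0 s, (s - u) ^ (β - 1) * f' u) s := by
    intro s
    simp only [indicator_apply (s := Ioo 0 t) (f := fun s => R s * _) (a := s)]
    split_ifs with hs
    · rw [← integral_const_mul, ← integral_indicator measurableSet_Ioo]
      refine integral_congr_ae (Eventually.of_forall fun u => ?_)
      simp only [hFdef, indicator_apply, if_pos hs]
      by_cases hu : u ∈ Ioo 0 s
      · rw [if_pos hu, if_pos ⟨sub_pos.2 hu.2, by linarith [hu.1, hs.2]⟩,
          if_pos ⟨hu.1, hu.2.trans hs.2⟩]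
        ring
      · rw [if_neg hu]
        by_cases hu0 : u ∈ Ioo 0 t
        · rw [if_neg fun h : s - u ∈ Ioo 0 t => hu ⟨hu0.1, sub_pos.1 h.1⟩]
          ring
        · rw [if_neg hu0, mul_zero]
    · simp [hs]
  have s1 : ∫ p : ℝ × ℝ, (Ioo 0 t).indicator R p.2 *
      (Ioo 0 t).indicator (fun v => v ^ (β - 1)) (p.2 - p.1) * F p.1 ∂(volume.prod volume) =
      ∫ s in Ioo 0 t, R s * ∫ u in Ioo 0 s, (s - u) ^ (β - 1) * f' u := by
    rw [integral_prod_symm _ hKint, ← integral_indicator measurableSet_Ioo]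
    exact integral_congr_ae (Eventually.of_forall inner)
  have s2 : ∫ p : ℝ × ℝ, (Ioo 0 t).indicator R p.2 *
      (Ioo 0 t).indicator (fun v => v ^ (β - 1)) (p.2 - p.1) * F p.1 ∂(volume.prod volume) =
      Real.Gamma β * ∫ u in Ioo 0 t, f' u * G u := by
    rw [integral_prod _ hKint, ← integral_const_mul, ← integral_indicator measurableSet_Ioo]
    refine integral_congr_ae (Eventually.of_forall fun u => ?_)
    simp only [indicator_apply (s := Ioo 0 t) (f := fun u => Real.Gamma β * (f' u * G u)) (a := u)]
    rw [integral_mul_const]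
    split_ifs with hu
    · have h1 := integral_sub_rpow_mul_rightWeyl hβ hq hu.1.le hu.2 htT hG hEG
      have h2 : F u = f' u := indicator_of_mem hu _
      rw [h2, show Real.Gamma β * (f' u * G u) = Real.Gamma β * G u * f' u by ring, ← h1,
        ← integral_indicator measurableSet_Ioo]
      congr 1
      refine integral_congr_ae (Eventually.of_forall fun s => ?_)
      simp only [indicator_apply]
      by_cases hs : s ∈ Ioo u t
      · rw [if_pos hs, if_pos ⟨hu.1.trans hs.1, hs.2⟩,
          if_pos ⟨sub_pos.2 hs.1, by linarith [hu.1, hs.2]⟩, mul_comm]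
      · rw [if_neg hs]
        by_cases hs0 : s ∈ Ioo 0 t
        · rw [if_neg fun h : s - u ∈ Ioo 0 t => hs ⟨sub_pos.1 h.1, hs0.2⟩, mul_zero]
        · rw [if_neg hs0, zero_mul]
    · have h2 : F u = 0 := indicator_of_notMem hu _
      rw [h2, mul_zero]
  have s3 : IntegrableOn (fun s => R s * ∫ u in Ioo 0 s, (s - u) ^ (β - 1) * f' u)
      (Ioo 0 t) := by
    rw [← integrable_indicator_iff measurableSet_Ioo]
    exact hKint.integral_prod_right.congr (Eventually.of_forall inner)
  have h0 : ∫ s in Ioo 0 t, s ^ (β - 1) * R s = Real.Gamma β * G 0 :=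
    integral_rpow_mul_rightWeyl hβ hq ht hG hEt
  have hft : ∫ s in (0 : ℝ)..t, f' s = f t - f 0 :=
    intervalIntegral.integral_eq_sub_of_hasDerivAt (fun u _ => hf u)
      (hf'.intervalIntegrable _ _)
  have hfG : ∫ s in Ioo 0 t, f' s * G s =
      (∫ s in (0 : ℝ)..t, f' s * g s) - g t * (f t - f 0) := by
    rw [← integral_Ioc_eq_integral_Ioo, ← intervalIntegral.integral_of_le ht.le, ← hft,
      ← intervalIntegral.integral_const_mul, ← intervalIntegral.integral_sub
        (Continuous.intervalIntegrable (by fun_prop) _ _)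
        (Continuous.intervalIntegrable (by fun_prop) _ _)]
    refine intervalIntegral.integral_congr fun s _ => ?_
    simp only [hGdef]
    ring
  have main : ∫ s in Ioo 0 t, R s * leftWeyl α f s = f 0 * G 0 + ∫ s in Ioo 0 t, f' s * G s := by
    have e1 : ∀ s ∈ Ioo 0 t, R s * leftWeyl α f s = (Real.Gamma β)⁻¹ *
        (f 0 * (s ^ (β - 1) * R s) +
          R s * ∫ u in Ioo 0 s, (s - u) ^ (β - 1) * f' u) := fun s hs => by
      rw [leftWeyl_eq_of_hasDerivAt ⟨hα.1, by linarith [hα.2]⟩ hs.1 hf hf', hα1,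
        show -α = β - 1 by rw [hβdef]; ring]
      ring
    rw [setIntegral_congr_fun measurableSet_Ioo e1, integral_const_mul,
      integral_add (hR1.const_mul _) s3, integral_const_mul, h0, ← s1, s2]
    field_simp
  rw [genStieltjes, intervalIntegral.integral_of_le ht.le, integral_Ioc_eq_integral_Ioo, hα1]
  simp only [smul_eq_mul]
  rw [main, hfG]
  simp only [hGdef]
  ring

/-! ### The scalar linear equation -/

/-- The solution of `dx = -γ x dt + dg`, `x 0 = 0`, for a continuous path `g` with `g 0 = 0`,
in the form obtained by integrating the noise term by parts. -/
noncomputable def ouPath (γ : ℝ) (g : ℝ → ℝ) (t : ℝ) : ℝ :=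
  g t - γ * ∫ s in (0 : ℝ)..t, Real.exp (-(γ * (t - s))) * g s

section OU

variable {γ : ℝ} {g : ℝ → ℝ}

lemma hasDerivAt_exp_neg_mul_sub (γ t u : ℝ) :
    HasDerivAt (fun s => Real.exp (-(γ * (t - s)))) (γ * Real.exp (-(γ * (t - u)))) u := by
  refine ((((hasDerivAt_id u).const_sub t).const_mul γ).neg).exp.congr_deriv ?_
  simp only [id, Pi.neg_apply]
  ring

lemma genStieltjes_exp {α q t T : ℝ} (hα : α ∈ Ioo (0 : ℝ) (1 / 2))
    (hq : 2 * (1 - α) + 1 < q) (ht : t ∈ Icc 0 T) (hg : Continuous g) (hg0 : g 0 = 0)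
    (hE : gagliardo q T g < ⊤) :
    genStieltjes α t (fun s => Real.exp (-(γ * (t - s)))) g = ouPath γ g t := by
  rcases ht.1.eq_or_lt with rfl | ht0
  · simp [genStieltjes, ouPath, hg0]
  · rw [genStieltjes_eq_of_hasDerivAt hα hq ht0 ht.2 hg hE
      (hasDerivAt_exp_neg_mul_sub γ t) (by fun_prop), hg0, ouPath,
      ← intervalIntegral.integral_const_mul]
    simp [mul_assoc]

lemma hasDerivAt_integral_exp (hg : Continuous g) (t : ℝ) :
    HasDerivAt (fun t => ∫ s in (0 : ℝ)..t, Real.exp (-(γ * (t - s))) * g s)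
      (ouPath γ g t) t := by
  have e : ∀ t, ∫ s in (0 : ℝ)..t, Real.exp (-(γ * (t - s))) * g s =
      Real.exp (-(γ * t)) * ∫ s in (0 : ℝ)..t, Real.exp (γ * s) * g s := fun t => by
    rw [← intervalIntegral.integral_const_mul]
    refine intervalIntegral.integral_congr fun s _ => ?_
    rw [← mul_assoc, ← Real.exp_add]
    congr 2
    ring
  have hc : Continuous fun s => Real.exp (γ * s) * g s := by fun_prop
  have h1 : HasDerivAt (fun t : ℝ => Real.exp (-(γ * t))) (-γ * Real.exp (-(γ * t))) t := by
    refine (((hasDerivAt_id t).const_mul γ).neg).exp.congr_deriv ?_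
    simp only [id, Pi.neg_apply]
    ring
  have h2 := h1.mul (hc.integral_hasStrictDerivAt 0 t).hasDerivAt
  rw [funext e]
  refine h2.congr_deriv ?_
  rw [ouPath, e t, ← mul_assoc (Real.exp _), ← Real.exp_add, neg_add_cancel, Real.exp_zero]
  ring

lemma continuous_ouPath (hg : Continuous g) : Continuous (ouPath γ g) := by
  have : Continuous fun t => ∫ s in (0 : ℝ)..t, Real.exp (-(γ * (t - s))) * g s :=
    continuous_iff_continuousAt.2 fun t => (hasDerivAt_integral_exp hg t).continuousAt
  exact hg.sub (this.const_mul γ)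

lemma integral_ouPath (hg : Continuous g) (t : ℝ) :
    ∫ s in (0 : ℝ)..t, ouPath γ g s = ∫ s in (0 : ℝ)..t, Real.exp (-(γ * (t - s))) * g s := by
  rw [intervalIntegral.integral_eq_sub_of_hasDerivAt (fun s _ => hasDerivAt_integral_exp hg s)
    ((continuous_ouPath hg).intervalIntegrable _ _)]
  simp

lemma ouPath_eq (hg : Continuous g) (t : ℝ) :
    ouPath γ g t = -(γ * ∫ s in (0 : ℝ)..t, ouPath γ g s) + g t := by
  rw [integral_ouPath hg, ouPath]
  ring

/-- Uniqueness for the homogeneous equation, among merely integrable functions. -/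
lemma eq_zero_of_integral_equation {T : ℝ} (hT : 0 ≤ T) {d : ℝ → ℝ}
    (hd : IntegrableOn d (Icc 0 T)) (heq : ∀ t ∈ Icc 0 T, d t = -(γ * ∫ s in (0 : ℝ)..t, d s)) :
    ∀ t ∈ Icc 0 T, d t = 0 := by
  set D : ℝ → ℝ := fun t => ∫ s in (0 : ℝ)..t, d s with hD
  have hDc : ContinuousOn D (Icc 0 T) := by
    have := intervalIntegral.continuousOn_primitive_interval (a := 0) (b := T) (f := d)
      (μ := volume) (by rwa [uIcc_of_le hT])
    rwa [uIcc_of_le hT] at this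
  -- extend `D` continuously to the line, so that the fundamental theorem applies at end points
  set D' : ℝ → ℝ := fun t => D (max 0 (min T t)) with hD'
  have hD'c : Continuous D' := hDc.comp_continuous (by fun_prop)
    fun t => ⟨le_max_left _ _, max_le hT (min_le_left _ _)⟩
  have hDD' : ∀ t ∈ Icc 0 T, D' t = D t := fun t ht => by
    simp only [hD', min_eq_right ht.2, max_eq_right ht.1]
  set E : ℝ → ℝ := fun t => ∫ s in (0 : ℝ)..t, -(γ * D' s)
  have hED : ∀ t ∈ Icc 0 T, D t = E t := fun t ht => by
    refine intervalIntegral.integral_congr fun s hs => ?_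
    rw [uIcc_of_le ht.1] at hs
    have hs' : s ∈ Icc 0 T := ⟨hs.1, hs.2.trans ht.2⟩
    rw [heq s hs']
    simp only [hDD' s hs', hD]
  have hE' : ∀ t, HasDerivAt E (-(γ * D' t)) t := fun t =>
    ((by fun_prop : Continuous fun s => -(γ * D' s)).integral_hasStrictDerivAt 0 t).hasDerivAt
  have hconst := constant_of_has_deriv_right_zero (f := fun t => Real.exp (γ * t) * E t)
    (a := 0) (b := T) (fun t _ => (((by fun_prop :
      Continuous fun t : ℝ => Real.exp (γ * t)).continuousAt).mul
        (hE' t).continuousAt).continuousWithinAt) (fun t ht => by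
      have h1 : HasDerivAt (fun t : ℝ => Real.exp (γ * t)) (Real.exp (γ * t) * (γ * 1)) t :=
        ((hasDerivAt_id t).const_mul γ).exp
      have ht' : t ∈ Icc 0 T := ⟨ht.1, ht.2.le⟩
      refine ((h1.mul (hE' t)).congr_deriv ?_).hasDerivWithinAt
      rw [hDD' t ht', hED t ht']
      ring)
  intro t ht
  have h0 := hconst t ht
  have hE0 : E 0 = 0 := intervalIntegral.integral_same
  simp only [hE0, mul_zero, mul_eq_zero, (Real.exp_pos _).ne', false_or] at h0
  rw [heq t ht]
  have : D t = 0 := (hED t ht).trans h0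
  simp only [hD] at this
  rw [this, mul_zero, neg_zero]

/-- Uniqueness for the scalar linear integral equation. -/
lemma eq_ouPath {T : ℝ} (hT : 0 ≤ T) (hg : Continuous g) {z : ℝ → ℝ}
    (hz : IntegrableOn z (Icc 0 T))
    (heq : ∀ t ∈ Icc 0 T, z t = -(γ * ∫ s in (0 : ℝ)..t, z s) + g t) :
    ∀ t ∈ Icc 0 T, z t = ouPath γ g t := by
  have hx : IntegrableOn (ouPath γ g) (Icc 0 T) := (continuous_ouPath hg).integrableOn_Icc
  have key := eq_zero_of_integral_equation (γ := γ) hT (hz.sub hx) fun t ht => by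
    have hzt : IntervalIntegrable z volume 0 t :=
      (intervalIntegrable_iff_integrableOn_Icc_of_le ht.1).2
        (hz.mono_set (Icc_subset_Icc_right ht.2))
    simp only [Pi.sub_apply]
    rw [intervalIntegral.integral_sub hzt ((continuous_ouPath hg).intervalIntegrable _ _),
      ouPath_eq hg t, heq t ht]
    ring
  intro t ht
  exact sub_eq_zero.1 (key t ht)

/-- The bound is uniform in `γ`, because the kernel `γ e^{-γ(t-s)}` has mass at most one. -/
lemma abs_ouPath_le {T M : ℝ} (hγ : 0 < γ) (hM : ∀ t ∈ Icc 0 T, |g t| ≤ M) :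
    ∀ t ∈ Icc 0 T, |ouPath γ g t| ≤ 2 * M := by
  intro t ht
  have hM0 : 0 ≤ M := (abs_nonneg _).trans (hM t ht)
  have hexp : ∫ s in (0 : ℝ)..t, γ * Real.exp (-(γ * (t - s))) = 1 - Real.exp (-(γ * t)) := by
    rw [intervalIntegral.integral_eq_sub_of_hasDerivAt
      (fun u _ => hasDerivAt_exp_neg_mul_sub γ t u)
      (Continuous.intervalIntegrable (by fun_prop) _ _)]
    simp
  have h1 : |γ * ∫ s in (0 : ℝ)..t, Real.exp (-(γ * (t - s))) * g s| ≤ M := by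
    rw [← intervalIntegral.integral_const_mul, ← Real.norm_eq_abs]
    calc ‖∫ s in (0 : ℝ)..t, γ * (Real.exp (-(γ * (t - s))) * g s)‖
        ≤ ∫ s in (0 : ℝ)..t, γ * Real.exp (-(γ * (t - s))) * M := by
          refine intervalIntegral.norm_integral_le_of_norm_le ht.1
            (Eventually.of_forall fun s hs => ?_)
            (Continuous.intervalIntegrable (by fun_prop) _ _)
          rw [← mul_assoc, norm_mul, Real.norm_of_nonneg (by positivity)]
          exact mul_le_mul_of_nonneg_left (hM s ⟨hs.1.le, hs.2.trans ht.2⟩) (by positivity)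
      _ = (1 - Real.exp (-(γ * t))) * M := by rw [intervalIntegral.integral_mul_const, hexp]
      _ ≤ M := by nlinarith [Real.exp_pos (-(γ * t))]
  rw [ouPath]
  exact (abs_sub _ _).trans (by linarith [hM t ht])

/-- The drift part of `ouPath γ g` is Lipschitz, with a constant proportional to `γ`. -/
lemma abs_ouPath_sub_le {T M : ℝ} (hγ : 0 < γ) (hg : Continuous g)
    (hM : ∀ t ∈ Icc 0 T, |g t| ≤ M) {s u : ℝ} (hs : s ∈ Icc 0 T) (hu : u ∈ Icc 0 T) :
    |ouPath γ g s - ouPath γ g u| ≤ |g s - g u| + 2 * M * γ * |s - u| := by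
  have h1 := (convex_Icc (0 : ℝ) T).norm_image_sub_le_of_norm_hasDerivWithin_le
    (f := fun t => ∫ s in (0 : ℝ)..t, Real.exp (-(γ * (t - s))) * g s) (f' := ouPath γ g)
    (C := 2 * M) (fun x _ => (hasDerivAt_integral_exp hg x).hasDerivWithinAt)
    (fun x hx => abs_ouPath_le hγ hM x hx) hu hs
  simp only [Real.norm_eq_abs] at h1
  set Is := ∫ r in (0 : ℝ)..s, Real.exp (-(γ * (s - r))) * g r
  set Iu := ∫ r in (0 : ℝ)..u, Real.exp (-(γ * (u - r))) * g r
  have e : ouPath γ g s - ouPath γ g u = (g s - g u) - γ * (Is - Iu) := by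
    simp only [ouPath, Is, Iu]
    ring
  rw [e]
  refine (abs_sub _ _).trans (add_le_add le_rfl ?_)
  rw [abs_mul, abs_of_pos hγ]
  calc γ * |Is - Iu| ≤ γ * (2 * M * |s - u|) := mul_le_mul_of_nonneg_left h1 hγ.le
    _ = _ := by ring

end OU

lemma enorm_div_ofReal {E : Type*} [NormedAddCommGroup E] (x : E) {y : ℝ} (hy : 0 < y) :
    ‖x‖ₑ / ENNReal.ofReal y = ENNReal.ofReal (‖x‖ / y) := by
  rw [ENNReal.ofReal_div_of_pos hy, ofReal_norm]

lemma abs_le_pathEnergy {β q T : ℝ} (hβ : β ∈ Ioo (1 / 2 : ℝ) 1) (hq : 2 * β + 1 < q) :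
    ∃ C, 0 ≤ C ∧ ∀ g : ℝ → ℝ, Continuous g → g 0 = 0 → pathEnergy β q T g < ⊤ →
      ∀ t ∈ Icc 0 T, |g t| ≤ C * (1 + (pathEnergy β q T g).toReal) := by
  obtain ⟨C, hC0, hC⟩ := sq_le_pathEnergy (T := T) hβ hq
  refine ⟨C + 1, by linarith, fun g hg hg0 hE t ht => ?_⟩
  have hE0 : 0 ≤ (pathEnergy β q T g).toReal := ENNReal.toReal_nonneg
  rcases ht.1.eq_or_lt with rfl | h0
  · rw [hg0, abs_zero]
    positivity
  · refine abs_le_of_sq_le_sq ((hC g hg hE t ⟨h0, ht.2⟩).trans ?_) (by positivity)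
    have h1 : 1 ≤ (C + 1) * (1 + (pathEnergy β q T g).toReal) := by nlinarith
    nlinarith

/-- The norm of `ouPath γ g` in `W^{α,1}` grows at most linearly in `γ`. -/
lemma lintegral_ouPath_le {α β q T : ℝ} (hα : α ∈ Ioo (0 : ℝ) (1 / 2))
    (hβ : β ∈ Ioo (1 / 2 : ℝ) 1) (hq : 2 * β + 1 < q) :
    ∃ K : ℝ≥0∞, K < ⊤ ∧ ∀ γ > 0, ∀ g : ℝ → ℝ, Continuous g → g 0 = 0 → pathEnergy β q T g < ⊤ →
      ∫⁻ s in Ioo 0 T, (‖ouPath γ g s‖ₑ / ENNReal.ofReal (s ^ α) +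
        ∫⁻ u in Ioo 0 s, ‖ouPath γ g s - ouPath γ g u‖ₑ / ENNReal.ofReal ((s - u) ^ (α + 1))) ≤
      K * ENNReal.ofReal ((1 + γ) * (1 + (pathEnergy β q T g).toReal)) := by
  obtain ⟨C, hC0, hC⟩ := abs_le_pathEnergy (T := T) hβ hq
  set A := ∫⁻ s in Ioo 0 T, ENNReal.ofReal (s ^ (-α))
  have hA : A < ⊤ := (integrableOn_Ioo_rpow (by linarith [hα.2])).setLIntegral_lt_top
  set P₁ := absPowMass (q + 2 * (-α - 1)) T
  have hP₁ : P₁ < ⊤ := absPowMass_lt_top (by linarith [hα.2, hβ.1])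
  set P₂ := absPowMass (-α) T
  have hP₂ : P₂ < ⊤ := absPowMass_lt_top (by linarith [hα.2])
  set V := ∫⁻ _ in Ioo 0 T, ENNReal.ofReal ((1 : ℝ) ^ 2)
  have hV : V < ⊤ := by simp [V]
  have hV' : (volume.restrict (Ioo 0 T)) univ = V := by simp [V]
  set c := ENNReal.ofReal (2 * C)
  have hc : c < ⊤ := ENNReal.ofReal_lt_top
  refine ⟨c * A + (1 + V * P₁ + c * (P₂ * V)), by
    simp only [ENNReal.add_lt_top]
    exact ⟨ENNReal.mul_lt_top hc hA, ⟨ENNReal.one_lt_top, ENNReal.mul_lt_top hV hP₁⟩,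
      ENNReal.mul_lt_top hc (ENNReal.mul_lt_top hP₂ hV)⟩, fun γ hγ g hg hg0 hE => ?_⟩
  set E := (pathEnergy β q T g).toReal with hEdef
  have hE0 : 0 ≤ E := ENNReal.toReal_nonneg
  set w := ENNReal.ofReal ((1 + γ) * (1 + E)) with hw
  set M := C * (1 + E) with hMdef
  have hM0 : 0 ≤ M := by positivity
  have hM : ∀ t ∈ Icc 0 T, |g t| ≤ M := hC g hg hg0 hE
  have w1 : 1 ≤ w := by
    rw [hw, ENNReal.one_le_ofReal]
    nlinarith
  have w2 : gagliardo q T g ≤ w := by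
    refine le_self_add.trans ((ENNReal.le_ofReal_iff_toReal_le hE.ne (by positivity)).2 ?_)
    show E ≤ _
    nlinarith
  have w3 : ENNReal.ofReal (2 * M) ≤ c * w := by
    rw [← ENNReal.ofReal_mul (by positivity)]
    refine ENNReal.ofReal_le_ofReal ?_
    rw [hMdef, ← mul_assoc]
    refine mul_le_mul_of_nonneg_left ?_ (by positivity)
    nlinarith
  have w4 : ENNReal.ofReal (2 * M * γ) ≤ c * w := by
    rw [← ENNReal.ofReal_mul (by positivity)]
    refine ENNReal.ofReal_le_ofReal ?_
    rw [hMdef, ← mul_assoc, mul_assoc]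
    refine mul_le_mul_of_nonneg_left ?_ (by positivity)
    nlinarith
  calc ∫⁻ s in Ioo 0 T, (‖ouPath γ g s‖ₑ / ENNReal.ofReal (s ^ α) +
        ∫⁻ u in Ioo 0 s, ‖ouPath γ g s - ouPath γ g u‖ₑ / ENNReal.ofReal ((s - u) ^ (α + 1)))
      ≤ ∫⁻ s in Ioo 0 T, (ENNReal.ofReal (2 * M) * ENNReal.ofReal (s ^ (-α)) +
          ((∫⁻ u in Ioo 0 T, ENNReal.ofReal (1 * |g s - g u| * |s - u| ^ (-α - 1))) +
            ENNReal.ofReal (2 * M * γ) * P₂)) := by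
        refine setLIntegral_mono' measurableSet_Ioo fun s hs => add_le_add ?_ ?_
        · rw [enorm_div_ofReal _ (Real.rpow_pos_of_pos hs.1 _),
            ← ENNReal.ofReal_mul (by positivity), Real.rpow_neg hs.1.le, ← div_eq_mul_inv]
          refine ENNReal.ofReal_le_ofReal (div_le_div_of_nonneg_right
            (abs_ouPath_le hγ hM s (Ioo_subset_Icc_self hs)) (Real.rpow_nonneg hs.1.le _))
        · calc ∫⁻ u in Ioo 0 s, ‖ouPath γ g s - ouPath γ g u‖ₑ / ENNReal.ofReal ((s - u) ^ (α + 1))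
              ≤ ∫⁻ u in Ioo 0 s, (ENNReal.ofReal (1 * |g s - g u| * |s - u| ^ (-α - 1)) +
                  ENNReal.ofReal (2 * M * γ) * ENNReal.ofReal (|s - u| ^ (-α))) := by
                refine setLIntegral_mono' measurableSet_Ioo fun u hu => ?_
                have hsu : 0 < s - u := sub_pos.2 hu.2
                rw [enorm_div_ofReal _ (Real.rpow_pos_of_pos hsu _),
                  ← ENNReal.ofReal_mul (by positivity),
                  ← ENNReal.ofReal_add (by positivity) (by positivity)]
                refine ENNReal.ofReal_le_ofReal ?_
                have h1 := abs_ouPath_sub_le hγ hg hM (Ioo_subset_Icc_self hs)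
                  (⟨hu.1.le, (hu.2.trans hs.2).le⟩ : u ∈ Icc 0 T)
                rw [abs_of_pos hsu] at h1 ⊢
                have e1 : (s - u) ^ (-α) = (s - u) * (s - u) ^ (-α - 1) := by
                  rw [Real.rpow_sub_one hsu.ne']
                  field_simp
                rw [Real.norm_eq_abs, div_eq_mul_inv, ← Real.rpow_neg hsu.le, neg_add', e1]
                calc |ouPath γ g s - ouPath γ g u| * (s - u) ^ (-α - 1)
                    ≤ (|g s - g u| + 2 * M * γ * (s - u)) * (s - u) ^ (-α - 1) :=
                      mul_le_mul_of_nonneg_right h1 (Real.rpow_nonneg hsu.le _)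
                  _ = _ := by ring
            _ ≤ ∫⁻ u in Ioo 0 T, (ENNReal.ofReal (1 * |g s - g u| * |s - u| ^ (-α - 1)) +
                  ENNReal.ofReal (2 * M * γ) * ENNReal.ofReal (|s - u| ^ (-α))) :=
                lintegral_mono_set (Ioo_subset_Ioo_right hs.2.le)
            _ ≤ _ := by
                rw [lintegral_add_left (by fun_prop), lintegral_const_mul _ (by fun_prop)]
                gcongr
                exact lintegral_abs_sub_rpow_le hs
    _ = ENNReal.ofReal (2 * M) * A +
          ((∫⁻ s in Ioo 0 T, ∫⁻ u in Ioo 0 T,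
              ENNReal.ofReal (1 * |g s - g u| * |s - u| ^ (-α - 1))) +
            ENNReal.ofReal (2 * M * γ) * (P₂ * V)) := by
        rw [lintegral_add_left (by fun_prop), lintegral_const_mul _ (by fun_prop),
          lintegral_add_right _ (by fun_prop), lintegral_const, hV', mul_assoc]
    _ ≤ c * w * A + ((w + V * P₁ * w) + c * w * (P₂ * V)) := by
        refine add_le_add (mul_le_mul' w3 le_rfl) (add_le_add ?_ (mul_le_mul' w4 le_rfl))
        refine (lintegral_weight_mul_abs_sub_le (w := fun _ => 1) (-α - 1) q T hg.measurable
          measurable_const).trans (add_le_add w2 ?_)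
        calc V * P₁ = V * P₁ * 1 := (mul_one _).symm
          _ ≤ _ := mul_le_mul' le_rfl w1
    _ = _ := by ring

/-! ### The energy of fractional Brownian paths -/

section FBM

variable {Ω : Type*} [MeasurableSpace Ω] {P : Measure Ω} {h : ℝ} {B : ℝ≥0 → Ω → ℝ}

lemma tendsto_natFloor_div_toNNReal (s : ℝ) :
    Tendsto (fun n : ℕ => (⌊(s.toNNReal : ℝ) * (n + 1 : ℕ)⌋₊ : ℝ≥0) / (n + 1 : ℕ)) atTop
      (𝓝 s.toNNReal) := by
  rw [← NNReal.tendsto_coe]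
  have h1 := (tendsto_nat_floor_mul_div_atTop (R := ℝ) (s.toNNReal).2).comp
    (tendsto_natCast_atTop_atTop.comp (tendsto_add_atTop_nat 1))
  refine h1.congr fun n => ?_
  simp

/-- A process with almost surely continuous paths agrees, almost surely and for all times at once,
with a jointly measurable one. -/
lemma exists_measurable_version (hm : ∀ t, AEMeasurable (B t) P)
    (hc : ∀ᵐ ω ∂P, Continuous fun t => B t ω) :
    ∃ X : Ω × ℝ → ℝ, Measurable X ∧ ∀ᵐ ω ∂P, ∀ s, X (ω, s) = B s.toNNReal ω := by
  obtain ⟨C, hCm, hC⟩ : ∃ C : ℕ → ℕ → Ω → ℝ, (∀ n k, Measurable (C n k)) ∧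
      ∀ᵐ ω ∂P, ∀ n k : ℕ, B (k / (n + 1 : ℕ)) ω = C n k ω :=
    ⟨fun n k => (hm (k / (n + 1 : ℕ))).mk _, fun n k => (hm (k / (n + 1 : ℕ))).measurable_mk,
      ae_all_iff.2 fun n => ae_all_iff.2 fun k => (hm _).ae_eq_mk⟩
  obtain ⟨A, hA, hAm, hgood⟩ := (hc.and hC).exists_measurable_mem
  let X : Ω × ℝ → ℝ := (A ×ˢ univ).indicator fun p => B p.2.toNNReal p.1
  have hX : ∀ ω ∈ A, ∀ s, X (ω, s) = B s.toNNReal ω := fun ω hω s =>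
    indicator_of_mem (mk_mem_prod hω (mem_univ s)) _
  refine ⟨X, ?_, by filter_upwards [hA] with ω hω using hX ω hω⟩
  let Y : ℕ → Ω × ℝ → ℝ := fun n => (A ×ˢ univ).indicator fun p =>
    C n ⌊(p.2.toNNReal : ℝ) * (n + 1 : ℕ)⌋₊ p.1
  refine measurable_of_tendsto_metrizable (f := Y) (fun n => ?_) (tendsto_pi_nhds.2 fun p => ?_)
  · refine Measurable.indicator ?_ (hAm.prod MeasurableSet.univ)
    have h1 : Measurable fun p : Ω × ℕ => C n p.2 p.1 :=
      measurable_from_prod_countable_left fun k => hCm n k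
    have h2 : Measurable fun p : Ω × ℝ => (p.1, ⌊(p.2.toNNReal : ℝ) * (n + 1 : ℕ)⌋₊) := by
      fun_prop
    exact h1.comp h2
  · by_cases hp : p.1 ∈ A
    · have hp' : p ∈ A ×ˢ (univ : Set ℝ) := ⟨hp, mem_univ _⟩
      obtain ⟨hcont, hk⟩ := hgood p.1 hp
      have h1 := (hcont.tendsto p.2.toNNReal).comp (tendsto_natFloor_div_toNNReal p.2)
      have h2 : X p = B p.2.toNNReal p.1 := indicator_of_mem hp' _
      rw [h2]
      refine h1.congr fun n => ?_
      simp only [Y, indicator_of_mem hp', Function.comp_apply]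
      exact hk n _
    · have hp' : p ∉ A ×ˢ (univ : Set ℝ) := fun h => hp h.1
      simp only [X, Y, indicator_of_notMem hp']
      exact tendsto_const_nhds

lemma IsFBM.memLp_two (hB : IsFBM h B P) (t : ℝ≥0) : MemLp (B t) 2 P :=
  (hB.gaussian.hasGaussianLaw_eval t).memLp_two

lemma IsFBM.integral_sq (hB : IsFBM h B P) (hh : 0 < h) (t : ℝ≥0) : ∫ ω, B t ω ^ 2 ∂P = (t : ℝ) ^ (2 * h) := by
  have := hB.covariance t t
  rw [sub_self, abs_zero, Real.zero_rpow (by positivity)] at this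
  simp only [sq]
  rw [this]
  ring

lemma IsFBM.integral_sub_sq (hB : IsFBM h B P) (hh : 0 < h) (s t : ℝ≥0) :
    ∫ ω, (B s ω - B t ω) ^ 2 ∂P = |(s : ℝ) - t| ^ (2 * h) := by
  have i1 := (hB.memLp_two s).integrable_sq
  have i2 := (hB.memLp_two t).integrable_sq
  have i3 : Integrable (fun ω => B s ω * B t ω) P := (hB.memLp_two s).integrable_mul (hB.memLp_two t)
  have e : ∀ ω, (B s ω - B t ω) ^ 2 = (B s ω ^ 2 + B t ω ^ 2) - 2 * (B s ω * B t ω) :=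
    fun ω => by ring
  have i12 : Integrable (fun ω => B s ω ^ 2 + B t ω ^ 2) P := i1.add i2
  simp_rw [e]
  rw [integral_sub i12 (i3.const_mul 2), integral_add i1 i2, integral_const_mul,
    hB.integral_sq hh, hB.integral_sq hh, hB.covariance]
  ring

lemma IsFBM.lintegral_sub_sq (hB : IsFBM h B P) (hh : 0 < h) (s t : ℝ≥0) :
    ∫⁻ ω, ENNReal.ofReal ((B s ω - B t ω) ^ 2) ∂P =
      ENNReal.ofReal (|(s : ℝ) - t| ^ (2 * h)) := by
  rw [← hB.integral_sub_sq hh, ofReal_integral_eq_lintegral_ofReal]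
  · exact ((hB.memLp_two s).sub (hB.memLp_two t)).integrable_sq
  · exact Eventually.of_forall fun ω => sq_nonneg _

lemma IsFBM.lintegral_sq (hB : IsFBM h B P) (hh : 0 < h) (t : ℝ≥0) :
    ∫⁻ ω, ENNReal.ofReal (B t ω ^ 2) ∂P = ENNReal.ofReal ((t : ℝ) ^ (2 * h)) := by
  rw [← hB.integral_sq hh, ofReal_integral_eq_lintegral_ofReal]
  · exact (hB.memLp_two t).integrable_sq
  · exact Eventually.of_forall fun ω => sq_nonneg _

lemma IsFBM.ae_zero (hB : IsFBM h B P) (hh : 0 < h) : ∀ᵐ ω ∂P, B 0 ω = 0 := by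
  have h1 := hB.integral_sq hh 0
  rw [NNReal.coe_zero, Real.zero_rpow (by positivity),
    integral_eq_zero_iff_of_nonneg (fun ω => sq_nonneg _) (hB.memLp_two 0).integrable_sq] at h1
  filter_upwards [h1] with ω hω
  simpa using hω

/-- A bound for the expected energy of a fractional Brownian path. It is finite if
`q < 2 * h + 1` and `2 * β - 1 < 2 * h`. -/
lemma IsFBM.lintegral_pathEnergy_le [SFinite P] (hB : IsFBM h B P) (hh : 0 < h) (β q T : ℝ) :
    AEMeasurable (fun ω => pathEnergy β q T fun s => B s.toNNReal ω) P ∧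
    ∫⁻ ω, pathEnergy β q T (fun s => B s.toNNReal ω) ∂P ≤
      (∫⁻ _ in Ioo 0 T, absPowMass (2 * h - q) T) +
        ∫⁻ s in Ioo 0 T, ENNReal.ofReal (s ^ (2 * h - 2 * β)) := by
  obtain ⟨X, hXm, hX⟩ := exists_measurable_version (fun t => hB.gaussian.aemeasurable t)
    hB.continuous_paths
  have hpath : (fun ω => pathEnergy β q T fun s => B s.toNNReal ω) =ᵐ[P]
      fun ω => pathEnergy β q T fun s => X (ω, s) := by
    filter_upwards [hX] with ω hω
    simp only [hω]
  have m1 : Measurable fun p : (Ω × ℝ) × ℝ =>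
      ENNReal.ofReal ((X (p.1.1, p.1.2) - X (p.1.1, p.2)) ^ 2 * |p.1.2 - p.2| ^ (-q)) := by
    fun_prop
  have m2 : Measurable fun p : Ω × ℝ => ∫⁻ u in Ioo 0 T,
      ENNReal.ofReal ((X (p.1, p.2) - X (p.1, u)) ^ 2 * |p.2 - u| ^ (-q)) :=
    m1.lintegral_prod_right'
  have m3 : Measurable fun ω => gagliardo q T fun s => X (ω, s) := m2.lintegral_prod_right'
  have m4 : Measurable fun p : Ω × ℝ => ENNReal.ofReal (X (p.1, p.2) ^ 2 * p.2 ^ (-(2 * β))) := by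
    fun_prop
  have m5 : Measurable fun ω => pathEnergy β q T fun s => X (ω, s) :=
    m3.add m4.lintegral_prod_right'
  refine ⟨m5.aemeasurable.congr hpath.symm, ?_⟩
  rw [lintegral_congr_ae hpath]
  unfold pathEnergy
  rw [lintegral_add_left m3]
  refine add_le_add ?_ (le_of_eq ?_)
  · unfold gagliardo
    rw [lintegral_lintegral_swap m2.aemeasurable]
    refine setLIntegral_mono' measurableSet_Ioo fun s hs => ?_
    rw [lintegral_lintegral_swap (by unfold Function.uncurry; fun_prop)]
    refine le_trans ?_ (lintegral_abs_sub_rpow_le (p := 2 * h - q) hs)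
    refine setLIntegral_mono' measurableSet_Ioo fun u hu => ?_
    rcases eq_or_ne s u with rfl | hsu
    · simp
    · have hpos : 0 < |s - u| := abs_pos.2 (sub_ne_zero.2 hsu)
      have e : ∀ᵐ ω ∂P, ENNReal.ofReal ((X (ω, s) - X (ω, u)) ^ 2 * |s - u| ^ (-q)) =
          ENNReal.ofReal ((B s.toNNReal ω - B u.toNNReal ω) ^ 2) *
            ENNReal.ofReal (|s - u| ^ (-q)) := by
        filter_upwards [hX] with ω hω
        rw [hω, hω, ENNReal.ofReal_mul (sq_nonneg _)]
      rw [lintegral_congr_ae e, lintegral_mul_const' _ _ ENNReal.ofReal_ne_top,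
        hB.lintegral_sub_sq hh, Real.coe_toNNReal _ hs.1.le, Real.coe_toNNReal _ hu.1.le,
        ← ENNReal.ofReal_mul (by positivity), ← Real.rpow_add hpos, sub_eq_add_neg (2 * h)]
  · rw [lintegral_lintegral_swap m4.aemeasurable]
    refine setLIntegral_congr_fun measurableSet_Ioo fun s hs => ?_
    have e : ∀ᵐ ω ∂P, ENNReal.ofReal (X (ω, s) ^ 2 * s ^ (-(2 * β))) =
        ENNReal.ofReal (B s.toNNReal ω ^ 2) * ENNReal.ofReal (s ^ (-(2 * β))) := by
      filter_upwards [hX] with ω hω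
      rw [hω, ENNReal.ofReal_mul (sq_nonneg _)]
    rw [lintegral_congr_ae e, lintegral_mul_const' _ _ ENNReal.ofReal_ne_top,
      hB.lintegral_sq hh, Real.coe_toNNReal _ hs.1.le,
      ← ENNReal.ofReal_mul (Real.rpow_nonneg hs.1.le _), ← Real.rpow_add hs.1,
      sub_eq_add_neg (2 * h)]

end FBM

/-! ### Expansions in eigenvectors -/

section Hilbert

variable {H K : Type} [NormedAddCommGroup H] [InnerProductSpace ℝ H]
  [NormedAddCommGroup K] [InnerProductSpace ℝ K] {V : Submodule ℝ (WithLp 2 (H × K))}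

/-- The embedding of `𝒱` into `H`. -/
noncomputable def toH (V : Submodule ℝ (WithLp 2 (H × K))) : V →L[ℝ] H :=
  (WithLp.fstL 2 ℝ H K).comp V.subtypeL

/-- `inner_smul_right` for elements of `V`. With the scalar action of the submodule in the statement
it can be used for rewriting, which the general lemma cannot. -/
lemma inner_smul_right_of_subtype (c : ℝ) (v w : V) : inner ℝ v (c • w) = c * inner ℝ v w :=
  inner_smul_right v w c

/-- `real_inner_smul_left` for elements of `V`; see `inner_smul_right_of_subtype`. -/
lemma inner_smul_left_of_subtype (c : ℝ) (v w : V) : inner ℝ (c • v) w = c * inner ℝ v w :=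
  real_inner_smul_left v w c

namespace NoiseData

variable (N : NoiseData V)

lemma lam_nonneg (i : ℕ) : 0 ≤ N.lam i := by
  have h := N.G_pos.inner_nonneg_left (N.e i)
  rwa [N.G_eigen, inner_smul_left, real_inner_self_eq_norm_sq, N.e.orthonormal.1, one_pow, mul_one]
    at h

lemma summable_lam : Summable N.lam := by
  refine N.G_trace.congr fun i => ?_
  rw [N.G_eigen, inner_smul_left, real_inner_self_eq_norm_sq, N.e.orthonormal.1, one_pow, mul_one]
  rfl

lemma toH_f (i : ℕ) : toH V (N.f i) = N.e i := N.f_eq i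

lemma one_add_gam_pos (i : ℕ) : 0 < 1 + N.gam i := by linarith [N.gam_pos i]

/-- An eigenvector of `A` represents, in `𝒱`, a multiple of the corresponding coefficient in `H`. -/
lemma inner_f (i : ℕ) (w : V) :
    inner ℝ (N.f i) w = (1 + N.gam i) * inner ℝ (N.e i) (toH V w) := by
  have h := N.A_eigen i w
  rw [inner_smul_left] at h
  rw [Submodule.coe_inner, WithLp.prod_inner_apply, add_mul, one_mul]
  refine congrArg₂ _ ?_ h
  rw [← N.f_eq i]
  rfl

lemma inner_f_f (i j : ℕ) : inner ℝ (N.f i) (N.f j) = if i = j then 1 + N.gam i else 0 := by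
  rw [N.inner_f, N.toH_f, orthonormal_iff_ite.1 N.e.orthonormal]
  split_ifs <;> simp

lemma norm_f_sq (i : ℕ) : ‖N.f i‖ ^ 2 = 1 + N.gam i := by
  rw [← real_inner_self_eq_norm_sq, N.inner_f_f, if_pos rfl]

/-- The eigenvectors of `A`, normalized in `𝒱`. -/
noncomputable def unitVec (i : ℕ) : V := (√(1 + N.gam i))⁻¹ • N.f i

lemma orthonormal_unitVec : Orthonormal ℝ N.unitVec := by
  rw [orthonormal_iff_ite]
  intro i j
  rw [unitVec, unitVec, inner_smul_left_of_subtype, inner_smul_right_of_subtype, N.inner_f_f]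
  split_ifs with h
  · subst h
    have h1 : √(1 + N.gam i) ^ 2 = 1 + N.gam i := Real.sq_sqrt (N.one_add_gam_pos i).le
    have h2 : √(1 + N.gam i) ≠ 0 := (Real.sqrt_pos.2 (N.one_add_gam_pos i)).ne'
    field_simp
    rw [h1]
  · simp

/-- The closed span of the eigenvectors of `A` in `𝒱`. -/
noncomputable def eigenSpan : Submodule ℝ V := (Submodule.span ℝ (range N.f)).topologicalClosure

lemma f_mem_eigenSpan (i : ℕ) : N.f i ∈ N.eigenSpan :=
  Submodule.le_topologicalClosure _ (Submodule.subset_span ⟨i, rfl⟩)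

lemma inner_unitVec_smul (i : ℕ) (v : V) :
    inner ℝ (N.unitVec i) v • N.unitVec i = inner ℝ (N.e i) (toH V v) • N.f i := by
  have h1 : √(1 + N.gam i) ^ 2 = 1 + N.gam i := Real.sq_sqrt (N.one_add_gam_pos i).le
  have h2 : √(1 + N.gam i) ≠ 0 := (Real.sqrt_pos.2 (N.one_add_gam_pos i)).ne'
  rw [unitVec, inner_smul_left_of_subtype, N.inner_f, smul_smul]
  congr 1
  field_simp
  rw [h1]

lemma ext_inner_e {x y : H} (h : ∀ i, inner ℝ (N.e i) x = inner ℝ (N.e i) y) : x = y := by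
  refine N.e.repr.injective (lp.ext (funext fun i => ?_))
  rw [N.e.repr_apply_apply, N.e.repr_apply_apply, h]

lemma S_f (τ : ℝ) (i : ℕ) : N.S τ (N.f i) = Real.exp (-(N.gam i * τ)) • N.f i := by
  rw [S, tsum_eq_single i]
  · rw [N.f_eq, real_inner_self_eq_norm_sq, N.e.orthonormal.1, one_pow, mul_one]
  · intro j hj
    rw [N.f_eq, N.e.orthonormal.2 hj, mul_zero, zero_smul]

variable [CompleteSpace V]

instance : CompleteSpace N.eigenSpan :=
  (Submodule.isClosed_topologicalClosure _).completeSpace_coe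

/-- The expansion of an element of `𝒱` in eigenvectors converges in `𝒱` to its orthogonal
projection to their closed span. -/
lemma hasSum_starProjection (v : V) :
    HasSum (fun i => inner ℝ (N.e i) (toH V v) • N.f i) (N.eigenSpan.starProjection v) := by
  have hsum : Summable fun i => inner ℝ (N.unitVec i) v • N.unitVec i := by
    have h1 := (N.orthonormal_unitVec.orthogonalFamily.summable_iff_norm_sq_summable
      fun i => inner ℝ (N.unitVec i) v).2 (N.orthonormal_unitVec.inner_products_summable v)
    exact h1
  simp only [N.inner_unitVec_smul] at hsum
  convert hsum.hasSum using 1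
  refine Submodule.eq_starProjection_of_mem_of_inner_eq_zero ?_ ?_
  · exact (Submodule.isClosed_topologicalClosure _).mem_of_tendsto hsum.hasSum
      (Eventually.of_forall fun s => Submodule.sum_mem _ fun i _ =>
        Submodule.smul_mem _ _ (N.f_mem_eigenSpan i))
  · have h2 : ∀ i, inner ℝ (N.f i)
        (v - ∑' i, inner ℝ (N.e i) (toH V v) • N.f i) = 0 := fun i => by
      rw [inner_sub_right]
      have h3 := hsum.hasSum.mapL (innerSL ℝ (N.f i))
      have h4 := hasSum_single (f := fun j => innerSL ℝ (N.f i)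
        (inner ℝ (N.e j) (toH V v) • N.f j)) i fun j hj => by
          rw [innerSL_apply_apply, inner_smul_right_of_subtype, N.inner_f_f, if_neg hj.symm, mul_zero]
      have h5 := h3.unique h4
      rw [innerSL_apply_apply, innerSL_apply_apply, inner_smul_right_of_subtype, N.inner_f_f,
        if_pos rfl] at h5
      rw [h5, N.inner_f]
      ring
    intro w hw
    rw [real_inner_comm]
    have hle : N.eigenSpan ≤ (ℝ ∙ (v - ∑' i, inner ℝ (N.e i) (toH V v) • N.f i))ᗮ := by
      refine Submodule.topologicalClosure_minimal _ (Submodule.span_le.2 ?_)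
        (Submodule.isClosed_orthogonal _)
      rintro _ ⟨i, rfl⟩
      exact Submodule.mem_orthogonal_singleton_iff_inner_left.2 (h2 i)
    exact Submodule.mem_orthogonal_singleton_iff_inner_left.1 (hle hw)

lemma toH_starProjection (v : V) : toH V (N.eigenSpan.starProjection v) = toH V v := by
  refine N.ext_inner_e fun i => ?_
  have h1 : inner ℝ (N.f i) (v - N.eigenSpan.starProjection v) = 0 :=
    (Submodule.mem_orthogonal _ _).1 (Submodule.sub_starProjection_mem_orthogonal v) _
      (N.f_mem_eigenSpan i)
  rw [N.inner_f, map_sub, inner_sub_right, mul_eq_zero] at h1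
  rcases h1 with h1 | h1
  · exact absurd h1 (N.one_add_gam_pos i).ne'
  · linarith

end NoiseData

end Hilbert

lemma genStieltjes_smul_const {E : Type} [NormedAddCommGroup E] [NormedSpace ℝ E] [CompleteSpace E]
    (α T : ℝ) (φ g : ℝ → ℝ) (v : E) :
    genStieltjes α T (fun s => φ s • v) g = genStieltjes α T φ g • v := by
  have h : ∀ s, leftWeyl α (fun s => φ s • v) s = leftWeyl α φ s • v := fun s => by
    simp only [leftWeyl]
    simp only [← sub_smul, ← smul_assoc]
    rw [intervalIntegral.integral_smul_const, ← smul_assoc, ← add_smul, ← smul_assoc]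
  rw [genStieltjes, genStieltjes, neg_smul, ← intervalIntegral.integral_smul_const]
  simp only [h, smul_assoc]

/-! ### The two notions of solution, path by path -/

section MemW

variable {E F : Type} [NormedAddCommGroup E] [NormedSpace ℝ E] [NormedAddCommGroup F]
  [NormedSpace ℝ F] {α T : ℝ} {f : ℝ → E}

lemma MemW.comp_contraction (hf : MemW α T f) (L : E →L[ℝ] F) (hL : ∀ x, ‖L x‖ ≤ ‖x‖) :
    MemW α T (fun s => L (f s)) := by
  have hL' : ∀ x, ‖L x‖ₑ ≤ ‖x‖ₑ := fun x => by
    rw [← ofReal_norm, ← ofReal_norm]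
    exact ENNReal.ofReal_le_ofReal (hL x)
  refine ⟨L.continuous.comp_aestronglyMeasurable hf.1, lt_of_le_of_lt ?_ hf.2⟩
  refine lintegral_mono fun s => add_le_add (ENNReal.div_le_div_right (hL' _) _)
    (lintegral_mono fun u => ENNReal.div_le_div_right ?_ _)
  rw [← map_sub]
  exact hL' _

end MemW

lemma MemW.integrableOn {E : Type} [NormedAddCommGroup E] {α T : ℝ} {f : ℝ → E} (hα : 0 ≤ α) (hf : MemW α T f) : IntegrableOn f (Icc 0 T) := by
  rw [integrableOn_Icc_iff_integrableOn_Ioo]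
  refine ⟨hf.1.mono_measure (Measure.restrict_mono_set _ Ioo_subset_Icc_self), ?_⟩
  have h1 : ∫⁻ s in Ioo 0 T, ‖f s‖ₑ ≤
      ENNReal.ofReal (T ^ α) * ∫⁻ s in Ioo 0 T, (‖f s‖ₑ / ENNReal.ofReal (s ^ α) +
        ∫⁻ u in Ioo 0 s, ‖f s - f u‖ₑ / ENNReal.ofReal ((s - u) ^ (α + 1))) := by
    rw [← lintegral_const_mul' _ _ ENNReal.ofReal_ne_top]
    refine setLIntegral_mono' measurableSet_Ioo fun s hs => ?_
    refine le_trans ?_ (mul_le_mul' le_rfl le_self_add)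
    rw [enorm_div_ofReal _ (Real.rpow_pos_of_pos hs.1 _),
      ← ENNReal.ofReal_mul (Real.rpow_nonneg (hs.1.trans hs.2).le _), ← ofReal_norm]
    refine ENNReal.ofReal_le_ofReal ?_
    rw [mul_div_assoc', le_div_iff₀ (Real.rpow_pos_of_pos hs.1 _), mul_comm]
    exact mul_le_mul_of_nonneg_right (Real.rpow_le_rpow hs.1.le hs.2.le hα) (norm_nonneg _)
  exact h1.trans_lt (ENNReal.mul_lt_top ENNReal.ofReal_lt_top hf.2)

lemma ouPath_const_mul (γ c : ℝ) (g : ℝ → ℝ) (t : ℝ) :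
    ouPath γ (fun s => c * g s) t = c * ouPath γ g t := by
  have : ∫ s in (0 : ℝ)..t, Real.exp (-(γ * (t - s))) * (c * g s) =
      c * ∫ s in (0 : ℝ)..t, Real.exp (-(γ * (t - s))) * g s := by
    rw [← intervalIntegral.integral_const_mul]
    congr 1
    ext s
    ring
  rw [ouPath, ouPath, this]
  ring

lemma measurable_lintegral_Ioo {F : ℝ × ℝ → ℝ≥0∞} (hF : Measurable F) :
    Measurable fun s => ∫⁻ u in Ioo 0 s, F (s, u) := by
  have h1 : Measurable fun p : ℝ × ℝ => {p : ℝ × ℝ | 0 < p.2 ∧ p.2 < p.1}.indicator F p :=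
    hF.indicator ((measurableSet_lt measurable_const measurable_snd).inter
      (measurableSet_lt measurable_snd measurable_fst))
  have h2 := h1.lintegral_prod_right' (ν := volume)
  have e : (fun s => ∫⁻ u in Ioo 0 s, F (s, u)) =
      fun s => ∫⁻ u, {p : ℝ × ℝ | 0 < p.2 ∧ p.2 < p.1}.indicator F (s, u) := by
    ext s
    rw [← lintegral_indicator measurableSet_Ioo]
    rfl
  rw [e]
  exact h2

section Pathwise

variable {H K : Type} [NormedAddCommGroup H] [InnerProductSpace ℝ H]
  [NormedAddCommGroup K] [InnerProductSpace ℝ K] {V : Submodule ℝ (WithLp 2 (H × K))}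

namespace NoiseData

/-- The properties of the family of noise paths that hold almost surely and from which the
equivalence of the two notions of solution follows path by path. -/
structure RegularNoise (N : NoiseData V) (β q T : ℝ) (b : ℕ → ℝ → ℝ) : Prop where
  continuous : ∀ i, Continuous (b i)
  zero : ∀ i, b i 0 = 0
  energy : ∀ i, pathEnergy β q T (b i) < ⊤
  summable : Summable fun i => N.lam i * (1 + (pathEnergy β q T (b i)).toReal)

/-- The noise `∑ᵢ √λᵢ bᵢ(t) eᵢ` built from the paths `bᵢ`. -/
noncomputable def noise (N : NoiseData V) (b : ℕ → ℝ → ℝ) (t : ℝ) : H :=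
  ∑' i, (√(N.lam i) * b i t) • N.e i

/-- The coefficients of the stochastic convolution. -/
noncomputable def ouCoeff (N : NoiseData V) (b : ℕ → ℝ → ℝ) (t : ℝ) (i : ℕ) : ℝ :=
  √(N.lam i) * ouPath (N.gam i) (b i) t

variable {N : NoiseData V} {α β q T : ℝ} {b : ℕ → ℝ → ℝ}

lemma continuous_ouCoeff (hb : N.RegularNoise β q T b) (i : ℕ) :
    Continuous fun t => N.ouCoeff b t i :=
  (continuous_ouPath (hb.continuous i)).const_mul _

lemma ouCoeff_eq (hb : N.RegularNoise β q T b) (t : ℝ) (i : ℕ) :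
    N.ouCoeff b t i = -(N.gam i * ∫ s in (0 : ℝ)..t, N.ouCoeff b s i) + √(N.lam i) * b i t := by
  unfold ouCoeff
  rw [intervalIntegral.integral_const_mul, ouPath_eq (hb.continuous i)]
  ring

lemma inner_e_noise [CompleteSpace H] (hβ : β ∈ Ioo (1 / 2 : ℝ) 1) (hq : 2 * β + 1 < q)
    (hb : N.RegularNoise β q T b) {t : ℝ} (ht : t ∈ Icc 0 T) (i : ℕ) :
    inner ℝ (N.e i) (N.noise b t) = √(N.lam i) * b i t := by
  obtain ⟨C, hC0, hC⟩ := sq_le_pathEnergy (T := T) hβ hq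
  have hsq : Summable fun i => ‖√(N.lam i) * b i t‖ ^ 2 := by
    refine Summable.of_nonneg_of_le (fun i => sq_nonneg _) (fun i => ?_) (hb.summable.mul_left C)
    rw [Real.norm_eq_abs, sq_abs, mul_pow, Real.sq_sqrt (N.lam_nonneg i), mul_left_comm]
    refine mul_le_mul_of_nonneg_left ?_ (N.lam_nonneg i)
    rcases ht.1.eq_or_lt with rfl | h0
    · rw [hb.zero, zero_pow two_ne_zero]
      have : 0 ≤ (pathEnergy β q T (b i)).toReal := ENNReal.toReal_nonneg
      positivity
    · exact hC _ (hb.continuous i) (hb.energy i) t ⟨h0, ht.2⟩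
  have hsum : Summable fun i => (√(N.lam i) * b i t) • N.e i :=
    (N.e.orthonormal.orthogonalFamily.summable_iff_norm_sq_summable
      fun i => √(N.lam i) * b i t).2 hsq
  have h3 := hsum.hasSum.mapL (innerSL ℝ (N.e i))
  have h4 := hasSum_single (f := fun j => innerSL ℝ (N.e i) ((√(N.lam j) * b j t) • N.e j)) i
    fun j hj => by
      rw [innerSL_apply_apply, inner_smul_right, N.e.orthonormal.2 hj.symm, mul_zero]
  have h5 := h3.unique h4
  rw [innerSL_apply_apply, innerSL_apply_apply, inner_smul_right, real_inner_self_eq_norm_sq,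
    N.e.orthonormal.1, one_pow, mul_one] at h5
  exact h5

lemma inner_e_of_hasSum {c : ℕ → ℝ} {v : V} (h : HasSum (fun i => c i • N.f i) v) (i : ℕ) :
    inner ℝ (N.e i) (toH V v) = c i := by
  have h3 := (h.mapL (toH V)).mapL (innerSL ℝ (N.e i))
  have h4 := hasSum_single (f := fun j => innerSL ℝ (N.e i) (toH V (c j • N.f j))) i
    fun j hj => by
      rw [map_smul, N.toH_f, innerSL_apply_apply, inner_smul_right, N.e.orthonormal.2 hj.symm,
        mul_zero]
  have h5 := h3.unique h4
  rw [innerSL_apply_apply, map_smul, N.toH_f, innerSL_apply_apply, inner_smul_right,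
    real_inner_self_eq_norm_sq, N.e.orthonormal.1, one_pow, mul_one] at h5
  exact h5

lemma opAdj_e (i : ℕ) : OpAdj V (N.e i) (N.gam i • N.e i) := by
  intro v f hv
  have h1 := hv (N.f i)
  have h2 := N.A_eigen i v
  rw [N.f_eq] at h1
  rw [← h1, real_inner_comm, h2, real_inner_smul_left, inner_smul_right, real_inner_comm]

lemma gam_mul_inner_of_opAdj {ξ η : H} (h : OpAdj V ξ η) (i : ℕ) :
    N.gam i * inner ℝ (N.e i) ξ = inner ℝ (N.e i) η := by
  have h1 := h (N.f i) _ (N.A_eigen i)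
  rwa [real_inner_smul_left, N.f_eq] at h1

/-- A path with the coefficients of the stochastic convolution satisfies the weak equation. -/
lemma weak_equation_of_coeff [CompleteSpace H] (hβ : β ∈ Ioo (1 / 2 : ℝ) 1) (hq : 2 * β + 1 < q)
    (hb : N.RegularNoise β q T b) {z : ℝ → H} (hz : IntegrableOn z (Icc 0 T))
    (hcoeff : ∀ t ∈ Icc 0 T, ∀ i, inner ℝ (N.e i) (z t) = N.ouCoeff b t i)
    {ξ η : H} (hξ : OpAdj V ξ η) {t : ℝ} (ht : t ∈ Icc 0 T) :
    inner ℝ (z t) ξ = -(∫ s in (0 : ℝ)..t, inner ℝ (z s) η) + inner ℝ (N.noise b t) ξ := by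
  have hzt : IntervalIntegrable z volume 0 t :=
    (intervalIntegrable_iff_integrableOn_Icc_of_le ht.1).2
      (hz.mono_set (Icc_subset_Icc_right ht.2))
  set I := ∫ s in (0 : ℝ)..t, z s with hI
  have hIx : ∀ x : H, ∫ s in (0 : ℝ)..t, inner ℝ (z s) x = inner ℝ I x := fun x => by
    have := (innerSL ℝ x).intervalIntegral_comp_comm hzt
    simp only [innerSL_apply_apply] at this
    simp only [real_inner_comm x]
    exact this
  have hIe : ∀ i, inner ℝ I (N.e i) = ∫ s in (0 : ℝ)..t, N.ouCoeff b s i := fun i => by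
    rw [← hIx]
    refine intervalIntegral.integral_congr fun s hs => ?_
    rw [uIcc_of_le ht.1] at hs
    rw [real_inner_comm, hcoeff s ⟨hs.1, hs.2.trans ht.2⟩]
  rw [hIx]
  have h1 := N.e.hasSum_inner_mul_inner (z t) ξ
  have h2 := N.e.hasSum_inner_mul_inner I η
  have h3 := N.e.hasSum_inner_mul_inner (N.noise b t) ξ
  refine h1.unique ?_
  refine (h2.neg.add h3).congr_fun fun i => ?_
  rw [real_inner_comm (N.e i) (z t), hcoeff t ht, hIe,
    real_inner_comm (N.e i) (N.noise b t), inner_e_noise hβ hq hb ht,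
    ← N.gam_mul_inner_of_opAdj hξ, ouCoeff_eq hb]
  ring

/-- The coefficients of a path satisfying the weak equation are those of the stochastic
convolution. -/
lemma coeff_of_weak_equation [CompleteSpace H] (hβ : β ∈ Ioo (1 / 2 : ℝ) 1) (hq : 2 * β + 1 < q)
    (hT : 0 ≤ T) (hb : N.RegularNoise β q T b) {z : ℝ → H} (hz : IntegrableOn z (Icc 0 T))
    (hweak : ∀ t ∈ Icc 0 T, ∀ ξ η : H, OpAdj V ξ η →
      inner ℝ (z t) ξ = -(∫ s in (0 : ℝ)..t, inner ℝ (z s) η) + inner ℝ (N.noise b t) ξ) :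
    ∀ t ∈ Icc 0 T, ∀ i, inner ℝ (N.e i) (z t) = N.ouCoeff b t i := by
  intro t ht i
  have hzi : IntegrableOn (fun s => inner ℝ (N.e i) (z s)) (Icc 0 T) := hz.const_inner (N.e i)
  have key := eq_ouPath (γ := N.gam i) hT ((hb.continuous i).const_mul √(N.lam i)) hzi
    fun s hs => by
      have h1 := hweak s hs _ _ (N.opAdj_e i)
      rw [real_inner_comm, h1, real_inner_comm, inner_e_noise hβ hq hb hs]
      simp only [inner_smul_right, intervalIntegral.integral_const_mul, real_inner_comm (N.e i)]
  rw [key t ht, ouPath_const_mul, ouCoeff]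

/-- A regular path with the coefficients of the stochastic convolution may be lifted to `𝒱` so
that the lift is the sum of the series. -/
lemma exists_lift_hasSum [CompleteSpace V] {z : ℝ → H} {ζ : ℝ → V}
    (hζ : IsRegularLift V α T z ζ)
    (hcoeff : ∀ t ∈ Icc 0 T, ∀ i, inner ℝ (N.e i) (z t) = N.ouCoeff b t i) :
    ∃ ζ' : ℝ → V, IsRegularLift V α T z ζ' ∧
      ∀ t ∈ Icc 0 T, HasSum (fun i => N.ouCoeff b t i • N.f i) (ζ' t) := by
  refine ⟨fun t => N.eigenSpan.starProjection (ζ t), ⟨fun t ht => ?_, ?_⟩, fun t ht => ?_⟩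
  · rw [← hζ.1 t ht]
    exact N.toH_starProjection (ζ t)
  · exact hζ.2.comp_contraction _ fun x => Submodule.norm_starProjection_apply_le _ x
  · have h1 := N.hasSum_starProjection (ζ t)
    have h2 : toH V (ζ t) = z t := hζ.1 t ht
    simp only [h2, hcoeff t ht] at h1
    exact h1

/-- If the noise is smooth enough in space, the stochastic convolution is regular. -/
lemma exists_regular_lift [CompleteSpace H] [CompleteSpace V] (hα : α ∈ Ioo (0 : ℝ) (1 / 2))
    (hβ : β ∈ Ioo (1 / 2 : ℝ) 1) (hq : 2 * β + 1 < q) (hb : N.RegularNoise β q T b)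
    (hsum : Summable fun i => √(N.lam i) * (1 + N.gam i) ^ (5 / 2 : ℝ) *
      (1 + (pathEnergy β q T (b i)).toReal)) {z : ℝ → H}
    (hcoeff : ∀ t ∈ Icc 0 T, ∀ i, inner ℝ (N.e i) (z t) = N.ouCoeff b t i) :
    ∃ ζ : ℝ → V, IsRegularLift V α T z ζ := by
  obtain ⟨C, hC0, hC⟩ := abs_le_pathEnergy (T := T) hβ hq
  obtain ⟨A, hA, hAle⟩ := lintegral_ouPath_le (T := T) hα hβ hq
  set E : ℕ → ℝ := fun i => (pathEnergy β q T (b i)).toReal with hE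
  have hE0 : ∀ i, 0 ≤ E i := fun i => ENNReal.toReal_nonneg
  set a : ℕ → ℝ := fun i => √(N.lam i) * (1 + N.gam i) ^ (5 / 2 : ℝ) * (1 + E i) with ha
  have hnorm : ∀ i, ‖N.f i‖ = (1 + N.gam i) ^ (1 / 2 : ℝ) := fun i => by
    rw [← Real.sqrt_eq_rpow, ← N.norm_f_sq, Real.sqrt_sq (norm_nonneg _)]
  have hone : ∀ i, 1 ≤ 1 + N.gam i := fun i => by linarith [N.gam_pos i]
  have hbound : ∀ i, ∀ t ∈ Icc 0 T, ‖N.ouCoeff b t i • N.f i‖ ≤ 2 * C * a i := by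
    intro i t ht
    have h1 := abs_ouPath_le (N.gam_pos i) (hC _ (hb.continuous i) (hb.zero i) (hb.energy i)) t ht
    have h2 : (1 + N.gam i) ^ (1 / 2 : ℝ) ≤ (1 + N.gam i) ^ (5 / 2 : ℝ) :=
      Real.rpow_le_rpow_of_exponent_le (hone i) (by norm_num)
    rw [norm_smul, hnorm, ouCoeff, norm_mul, Real.norm_of_nonneg (Real.sqrt_nonneg _),
      Real.norm_eq_abs]
    calc √(N.lam i) * |ouPath (N.gam i) (b i) t| * (1 + N.gam i) ^ (1 / 2 : ℝ)
        ≤ √(N.lam i) * (2 * (C * (1 + E i))) * (1 + N.gam i) ^ (5 / 2 : ℝ) := by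
          have := hE0 i
          have := N.one_add_gam_pos i
          gcongr
      _ = 2 * C * a i := by simp only [ha]; ring
  have hsummable : ∀ t ∈ Icc 0 T, Summable fun i => N.ouCoeff b t i • N.f i := fun t ht =>
    Summable.of_norm_bounded (hsum.mul_left (2 * C)) fun i => hbound i t ht
  refine ⟨fun t => ∑' i, N.ouCoeff b t i • N.f i, fun t ht => ?_, ?_, ?_⟩
  · refine N.ext_inner_e fun i => ?_
    rw [hcoeff t ht]
    exact inner_e_of_hasSum (hsummable t ht).hasSum i
  · have : SecondCountableTopologyEither ℝ V := secondCountableTopologyEither_of_left ℝ V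
    refine ContinuousOn.aestronglyMeasurable ?_ measurableSet_Icc
    exact continuousOn_tsum (fun i => ((continuous_ouCoeff hb i).smul continuous_const).continuousOn)
      (hsum.mul_left (2 * C)) hbound
  · -- countable subadditivity of the norm of `W^{α,1}`
    set k : ℕ → ℝ≥0∞ := fun i => ENNReal.ofReal √(N.lam i) * ‖N.f i‖ₑ with hk
    have hkne : ∀ i, k i ≠ ⊤ := fun i => ENNReal.mul_ne_top ENNReal.ofReal_ne_top enorm_ne_top
    have e1 : ∀ i s, ‖N.ouCoeff b s i • N.f i‖ₑ = k i * ‖ouPath (N.gam i) (b i) s‖ₑ :=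
      fun i s => by
        rw [enorm_smul, ouCoeff, enorm_mul, Real.enorm_of_nonneg (Real.sqrt_nonneg _)]
        ring
    have e2 : ∀ i s u, ‖N.ouCoeff b s i • N.f i - N.ouCoeff b u i • N.f i‖ₑ =
        k i * ‖ouPath (N.gam i) (b i) s - ouPath (N.gam i) (b i) u‖ₑ := fun i s u => by
      rw [← sub_smul, enorm_smul, ouCoeff, ouCoeff, ← mul_sub, enorm_mul,
        Real.enorm_of_nonneg (Real.sqrt_nonneg _)]
      ring
    set D : ℕ → ℝ → ℝ≥0∞ := fun i s =>
      ‖ouPath (N.gam i) (b i) s‖ₑ / ENNReal.ofReal (s ^ α) +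
        ∫⁻ u in Ioo 0 s, ‖ouPath (N.gam i) (b i) s - ouPath (N.gam i) (b i) u‖ₑ /
          ENNReal.ofReal ((s - u) ^ (α + 1)) with hD
    have hxm : ∀ i, Measurable (ouPath (N.gam i) (b i)) := fun i =>
      (continuous_ouPath (hb.continuous i)).measurable
    have hDm2 : ∀ i, Measurable fun p : ℝ × ℝ =>
        ‖ouPath (N.gam i) (b i) p.1 - ouPath (N.gam i) (b i) p.2‖ₑ /
          ENNReal.ofReal ((p.1 - p.2) ^ (α + 1)) := fun i => by
      have := hxm i
      fun_prop
    have hDm : ∀ i, Measurable (D i) := fun i => by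
      have := hxm i
      exact Measurable.add (by fun_prop) (measurable_lintegral_Ioo (hDm2 i))
    calc _ ≤ ∫⁻ s in Ioo 0 T, ∑' i, k i * D i s := by
          refine setLIntegral_mono' measurableSet_Ioo fun s hs => ?_
          simp only [hD, mul_add]
          rw [ENNReal.tsum_add]
          refine add_le_add ?_ ?_
          · calc _ ≤ (∑' i, ‖N.ouCoeff b s i • N.f i‖ₑ) / ENNReal.ofReal (s ^ α) :=
                  ENNReal.div_le_div_right enorm_tsum_le_tsum_enorm _
              _ = _ := by
                  simp only [e1, div_eq_mul_inv, ← ENNReal.tsum_mul_right, mul_assoc]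
          · calc _ ≤ ∫⁻ u in Ioo 0 s, ∑' i, k i *
                    (‖ouPath (N.gam i) (b i) s - ouPath (N.gam i) (b i) u‖ₑ /
                      ENNReal.ofReal ((s - u) ^ (α + 1))) := by
                  refine setLIntegral_mono' measurableSet_Ioo fun u hu => ?_
                  have hs' : s ∈ Icc 0 T := Ioo_subset_Icc_self hs
                  have hu' : u ∈ Icc 0 T := ⟨hu.1.le, (hu.2.trans hs.2).le⟩
                  rw [← (hsummable s hs').tsum_sub (hsummable u hu')]
                  refine (ENNReal.div_le_div_right enorm_tsum_le_tsum_enorm _).trans (le_of_eq ?_)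
                  simp only [div_eq_mul_inv, ← ENNReal.tsum_mul_right]
                  exact tsum_congr fun i => (congrArg (· * _) (e2 i s u)).trans (mul_assoc _ _ _)
              _ = _ := by
                  have hm : ∀ i, Measurable fun u =>
                      ‖ouPath (N.gam i) (b i) s - ouPath (N.gam i) (b i) u‖ₑ /
                        ENNReal.ofReal ((s - u) ^ (α + 1)) := fun i =>
                    (hDm2 i).comp (measurable_const.prodMk measurable_id)
                  rw [lintegral_tsum fun i => ((hm i).const_mul (k i)).aemeasurable]
                  refine tsum_congr fun i => ?_
                  exact lintegral_const_mul' _ _ (hkne i)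
      _ = ∑' i, k i * ∫⁻ s in Ioo 0 T, D i s := by
          rw [lintegral_tsum fun i => ((hDm i).const_mul (k i)).aemeasurable]
          exact tsum_congr fun i => lintegral_const_mul' _ _ (hkne i)
      _ ≤ ∑' i, A * ENNReal.ofReal (a i) := by
          refine ENNReal.tsum_le_tsum fun i => ?_
          have h1 := hAle (N.gam i) (N.gam_pos i) (b i) (hb.continuous i) (hb.zero i) (hb.energy i)
          refine (mul_le_mul' le_rfl h1).trans ?_
          have hg := hone i
          have hg0 := N.one_add_gam_pos i
          rw [mul_left_comm]
          refine mul_le_mul' le_rfl ?_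
          simp only [hk]
          rw [← ofReal_norm, hnorm, ← ENNReal.ofReal_mul (Real.sqrt_nonneg _),
            ← ENNReal.ofReal_mul (by positivity)]
          refine ENNReal.ofReal_le_ofReal ?_
          have h2 : (1 + N.gam i) ^ (1 / 2 : ℝ) * (1 + N.gam i) ≤ (1 + N.gam i) ^ (5 / 2 : ℝ) := by
            rw [← Real.rpow_add_one hg0.ne']
            exact Real.rpow_le_rpow_of_exponent_le hg (by norm_num)
          calc √(N.lam i) * (1 + N.gam i) ^ (1 / 2 : ℝ) * ((1 + N.gam i) * (1 + E i))
              = √(N.lam i) * ((1 + N.gam i) ^ (1 / 2 : ℝ) * (1 + N.gam i)) * (1 + E i) := by ring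
            _ ≤ √(N.lam i) * (1 + N.gam i) ^ (5 / 2 : ℝ) * (1 + E i) := by
                have := hE0 i
                gcongr
      _ < ⊤ := by
          rw [ENNReal.tsum_mul_left]
          refine ENNReal.mul_lt_top hA ?_
          rw [← ENNReal.ofReal_tsum_of_nonneg (fun i => ?_) hsum]
          · exact ENNReal.ofReal_lt_top
          · have := hE0 i
            have := N.one_add_gam_pos i
            positivity

end NoiseData

end Pathwise

/-! ### The equivalence of the two notions of solution -/

section Assembly

variable {Ω : Type*} [MeasurableSpace Ω] {P : Measure Ω} {h β q : ℝ} {B : ℕ → ℝ≥0 → Ω → ℝ}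

lemma ae_summable_pathEnergy [IsProbabilityMeasure P] (hh : 0 < h) (hB : ∀ i, IsFBM h (B i) P)
    (hβ : 2 * β - 1 < 2 * h) (hq : q < 2 * h + 1) (T : ℝ) {a : ℕ → ℝ} (ha : ∀ i, 0 ≤ a i)
    (hsum : Summable a) :
    ∀ᵐ ω ∂P, (∀ i, pathEnergy β q T (fun s => B i s.toNNReal ω) < ⊤) ∧
      Summable fun i => a i * (1 + (pathEnergy β q T fun s => B i s.toNNReal ω).toReal) := by
  set C := (∫⁻ _ in Ioo 0 T, absPowMass (2 * h - q) T) +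
    ∫⁻ s in Ioo 0 T, ENNReal.ofReal (s ^ (2 * h - 2 * β)) with hCdef
  have hC : C < ⊤ := by
    refine ENNReal.add_lt_top.2 ⟨?_, (integrableOn_Ioo_rpow (by linarith)).setLIntegral_lt_top⟩
    rw [lintegral_const]
    exact ENNReal.mul_lt_top (absPowMass_lt_top (by linarith)) (by simp)
  have hE := fun i => (hB i).lintegral_pathEnergy_le hh β q T
  have h1 : ∀ᵐ ω ∂P, ∀ i, pathEnergy β q T (fun s => B i s.toNNReal ω) < ⊤ :=
    ae_all_iff.2 fun i => ae_lt_top' (hE i).1 ((hE i).2.trans_lt hC).ne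
  have h2 : ∀ᵐ ω ∂P, ∑' i, ENNReal.ofReal (a i) *
      pathEnergy β q T (fun s => B i s.toNNReal ω) < ⊤ := by
    refine ae_lt_top' (AEMeasurable.tsum fun i => (hE i).1.const_mul _) (ne_of_lt ?_)
    rw [lintegral_tsum fun i => (hE i).1.const_mul _]
    calc _ ≤ ∑' i, ENNReal.ofReal (a i) * C := by
          refine ENNReal.tsum_le_tsum fun i => ?_
          rw [lintegral_const_mul' _ _ ENNReal.ofReal_ne_top]
          exact mul_le_mul' le_rfl (hE i).2
      _ < ⊤ := by
          rw [ENNReal.tsum_mul_right, ← ENNReal.ofReal_tsum_of_nonneg ha hsum]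
          exact ENNReal.mul_lt_top ENNReal.ofReal_lt_top hC
  filter_upwards [h1, h2] with ω hω1 hω2
  refine ⟨hω1, ?_⟩
  have h3 := hsum.add (ENNReal.summable_toReal hω2.ne)
  refine h3.congr fun i => ?_
  rw [ENNReal.toReal_mul, ENNReal.toReal_ofReal (ha i)]
  ring

variable {H K : Type} [NormedAddCommGroup H] [InnerProductSpace ℝ H]
  [NormedAddCommGroup K] [InnerProductSpace ℝ K] {V : Submodule ℝ (WithLp 2 (H × K))}

namespace NoiseData

lemma ae_regularNoise (N : NoiseData V) [IsProbabilityMeasure P] (hh : 0 < h)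
    (hB : ∀ i, IsFBM h (B i) P) (hβ : 2 * β - 1 < 2 * h) (hq : q < 2 * h + 1) (T : ℝ) :
    ∀ᵐ ω ∂P, N.RegularNoise β q T fun i s => B i s.toNNReal ω := by
  have h0 : ∀ᵐ ω ∂P, ∀ i, B i 0 ω = 0 := ae_all_iff.2 fun i => (hB i).ae_zero hh
  have hc : ∀ᵐ ω ∂P, ∀ i, Continuous fun t => B i t ω :=
    ae_all_iff.2 fun i => (hB i).continuous_paths
  filter_upwards [h0, hc, ae_summable_pathEnergy hh hB hβ hq T N.lam_nonneg N.summable_lam]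
    with ω h0 hc hE
  exact ⟨fun i => (hc i).comp continuous_real_toNNReal, fun i => by rw [Real.toNNReal_zero, h0],
    hE.1, hE.2⟩

lemma convTerm_eq {Ω : Type*} {B : ℕ → ℝ≥0 → Ω → ℝ} [CompleteSpace V] {N : NoiseData V} {α T : ℝ} (hα : α ∈ Ioo (0 : ℝ) (1 / 2))
    (hq : 2 * (1 - α) + 1 < q) {ω : Ω}
    (hb : N.RegularNoise (1 - α) q T fun i s => B i s.toNNReal ω) {t : ℝ} (ht : t ∈ Icc 0 T)
    (i : ℕ) :
    N.convTerm α B t ω i = N.ouCoeff (fun i s => B i s.toNNReal ω) t i • N.f i := by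
  have hE : gagliardo q T (fun s => B i s.toNNReal ω) < ⊤ := le_self_add.trans_lt (hb.energy i)
  rw [convTerm, ouCoeff, ← genStieltjes_exp hα hq ht (hb.continuous i) (hb.zero i) hE]
  simp only [N.S_f]
  rw [genStieltjes_smul_const, smul_smul]

/-- The weight of the second half of the theorem dominates the one used for the summation of the
convolution, since the eigenvalues of `A` are bounded below. -/
lemma summable_one_add_gam (N : NoiseData V)
    (hsum : Summable fun i => √(N.lam i) * N.gam i ^ (5 / 2 : ℝ)) :
    Summable fun i => √(N.lam i) * (1 + N.gam i) ^ (5 / 2 : ℝ) := by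
  set k := (N.gam 0)⁻¹ + 1 with hk
  have hk0 : 0 < k := by
    have := N.gam_pos 0
    positivity
  refine Summable.of_nonneg_of_le (fun i => mul_nonneg (Real.sqrt_nonneg _)
    (Real.rpow_nonneg (N.one_add_gam_pos i).le _)) (fun i => ?_) (hsum.mul_left (k ^ (5 / 2 : ℝ)))
  have h1 : 1 + N.gam i ≤ k * N.gam i := by
    have h2 : 1 ≤ (N.gam 0)⁻¹ * N.gam i := by
      rw [inv_mul_eq_div, one_le_div (N.gam_pos 0)]
      exact N.gam_mono (Nat.zero_le i)
    rw [hk, add_mul, one_mul]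
    linarith
  have h3 := Real.rpow_le_rpow (N.one_add_gam_pos i).le h1 (by norm_num : (0 : ℝ) ≤ 5 / 2)
  rw [Real.mul_rpow hk0.le (N.gam_pos i).le] at h3
  calc _ ≤ √(N.lam i) * (k ^ (5 / 2 : ℝ) * N.gam i ^ (5 / 2 : ℝ)) :=
        mul_le_mul_of_nonneg_left h3 (Real.sqrt_nonneg _)
    _ = _ := by ring

/-- The equivalence of mild and distributional solutions for an abstract form `(V, H)`. -/
theorem isMildSolution_iff [CompleteSpace H] [CompleteSpace V] (N : NoiseData V)
    [IsProbabilityMeasure P] {α T : ℝ} (hh : h ∈ Ioo (0 : ℝ) 1) (hα : α ∈ Ioo (1 - h) (1 / 2))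
    (hT : 0 < T) (hB : ∀ i, IsFBM h (B i) P) (Z : ℝ → Ω → H) :
    (IsMildSolution N P B α T Z ↔
      IsDistributionalSolution N P B T Z ∧ HasRegularPaths V P α T Z) ∧
    ((Summable fun i => √(N.lam i) * N.gam i ^ (5 / 2 : ℝ)) →
      (IsMildSolution N P B α T Z ↔ IsDistributionalSolution N P B T Z)) := by
  have hα' : α ∈ Ioo (0 : ℝ) (1 / 2) := ⟨by linarith [hα.1, hh.2], hα.2⟩
  have hβ : 1 - α ∈ Ioo (1 / 2 : ℝ) 1 := ⟨by linarith [hα.2], by linarith [hα'.1]⟩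
  -- any exponent strictly between `2 (1 - α) + 1` and `2 h + 1` would do
  obtain ⟨q, hq1, hq2⟩ : ∃ q, 2 * (1 - α) + 1 < q ∧ q < 2 * h + 1 :=
    exists_between (by linarith [hα.1])
  have hβh : 2 * (1 - α) - 1 < 2 * h := by linarith [hα.1]
  have hreg := N.ae_regularNoise hh.1 hB hβh hq2 T
  have mild_to : IsMildSolution N P B α T Z →
      IsDistributionalSolution N P B T Z ∧ HasRegularPaths V P α T Z := by
    rintro ⟨hm, hmild⟩
    refine ⟨⟨hm, ?_⟩, ?_⟩
    · filter_upwards [hmild, hreg] with ω ⟨ζ, hζ, hsum⟩ hb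
      have hz : IntegrableOn (fun s => Z s ω) (Icc 0 T) :=
        IntegrableOn.congr_fun ((toH V).integrable_comp (hζ.2.integrableOn hα'.1.le))
          (fun t ht => hζ.1 t ht) measurableSet_Icc
      refine ⟨hz, fun t ht ξ η hξ => weak_equation_of_coeff hβ hq1 hb hz (fun s hs i => ?_) hξ ht⟩
      have h1 := hsum s hs
      simp only [convTerm_eq hα' hq1 hb hs] at h1
      rw [← inner_e_of_hasSum h1 i]
      exact congrArg _ (hζ.1 s hs).symm
    · filter_upwards [hmild] with ω ⟨ζ, hζ, _⟩ using ⟨ζ, hζ⟩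
  have to_mild : IsDistributionalSolution N P B T Z → HasRegularPaths V P α T Z →
      IsMildSolution N P B α T Z := by
    rintro ⟨hm, hdist⟩ hpath
    refine ⟨hm, ?_⟩
    filter_upwards [hdist, hpath, hreg] with ω ⟨hz, hweak⟩ ⟨ζ, hζ⟩ hb
    obtain ⟨ζ', hζ', hsum⟩ := exists_lift_hasSum hζ
      (coeff_of_weak_equation hβ hq1 hT.le hb hz hweak)
    refine ⟨ζ', hζ', fun t ht => ?_⟩
    simp only [convTerm_eq hα' hq1 hb ht]
    exact hsum t ht
  refine ⟨⟨mild_to, fun h => to_mild h.1 h.2⟩, fun hsum =>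
    ⟨fun h => (mild_to h).1, fun hd => to_mild hd ?_⟩⟩
  filter_upwards [hd.2, hreg, ae_summable_pathEnergy hh.1 hB hβh hq2 T
    (fun i => mul_nonneg (Real.sqrt_nonneg _) (Real.rpow_nonneg (N.one_add_gam_pos i).le _))
    (N.summable_one_add_gam hsum)] with ω ⟨hz, hweak⟩ hb hE
  exact exists_regular_lift hα' hβ hq1 hb hE.2
    (coeff_of_weak_equation hβ hq1 hT.le hb hz hweak)

end NoiseData

end Assembly

instance completeSpace_velocityV (M : Set Plane) : CompleteSpace (velocityV M) :=
  (Submodule.isClosed_topologicalClosure _).completeSpace_coe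

instance completeSpace_temperatureV (M : Set Plane) (κ : ℝ) : CompleteSpace (temperatureV M κ) :=
  (Submodule.isClosed_topologicalClosure _).completeSpace_coe

instance completeSpace_velocityH (M : Set Plane) : CompleteSpace (VelocityH M) :=
  (Submodule.isClosed_topologicalClosure _).completeSpace_coe

end FracPE

theorem proposition2p3 {M : Set FracPE.Plane} (hM : FracPE.IsSmoothBoundedDomain M)
    {κ : ℝ} (hκ : 0 < κ) {Ω : Type*} [MeasurableSpace Ω] (P : Measure Ω) [IsProbabilityMeasure P]
    {h α T : ℝ} (hh : h ∈ Ioo (0 : ℝ) 1) (hα : α ∈ Ioo (1 - h) (1 / 2)) (hT : 0 < T)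
    (B : ℕ → ℝ≥0 → Ω → ℝ) (hB : ∀ i, FracPE.IsFBM h (B i) P)
    (hind : iIndepFun (fun i ω t => B i t ω) P)
    (N₁ : FracPE.NoiseData (FracPE.velocityV M))
    (N₂ : FracPE.NoiseData (FracPE.temperatureV M κ)) :
    (∀ Z : ℝ → Ω → FracPE.VelocityH M,
      (FracPE.IsMildSolution N₁ P B α T Z ↔
        FracPE.IsDistributionalSolution N₁ P B T Z ∧
          FracPE.HasRegularPaths (FracPE.velocityV M) P α T Z) ∧
      ((Summable fun i => √(N₁.lam i) * N₁.gam i ^ (5 / 2 : ℝ)) →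
        (FracPE.IsMildSolution N₁ P B α T Z ↔ FracPE.IsDistributionalSolution N₁ P B T Z))) ∧
    (∀ Z : ℝ → Ω → FracPE.TemperatureH M,
      (FracPE.IsMildSolution N₂ P B α T Z ↔
        FracPE.IsDistributionalSolution N₂ P B T Z ∧
          FracPE.HasRegularPaths (FracPE.temperatureV M κ) P α T Z) ∧
      ((Summable fun i => √(N₂.lam i) * N₂.gam i ^ (5 / 2 : ℝ)) →
        (FracPE.IsMildSolution N₂ P B α T Z ↔ FracPE.IsDistributionalSolution N₂ P B T Z))) :=
  ⟨fun Z => N₁.isMildSolution_iff hh hα hT hB Z, fun Z => N₂.isMildSolution_iff hh hα hT hB Z⟩
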